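/- Let $\mathbb F_4$ be a field with four elements, $\zeta$ a primitive element of $\mathbb F_4$, and $\xi$ a primitive element of $\mathbb F_{16}\supset\mathbb F_4$ with $\xi^2+\xi+\zeta=0$. Let $R=\mathbb F_4[x]/\langle x^{15}-1\rangle$. Identify $\vec c\in\mathbb F_4^{30}$, written row by row as a $15\times 2$ array $(c_{g,t})$, with $\vec c(x)=(c_0(x),c_1(x))\in R^2$, where $c_t(x)=\sum_{g=0}^{14}c_{g,t}x^g$. Over $\mathbb F_4$, the polynomial $x^{15}-1$ is the product of the nine irreducible polynomials $$x+1,\; x^2+\zeta x+1,\; x^2+\zeta^2x+1,\; x+\zeta,\; x+\zeta^2,\; x^2+x+\zeta,\; x^2+\zeta^2x+\zeta^2,\; x^2+x+\zeta^2,\; x^2+\zeta x+\zeta,$$ which have, in this order, the roots $1,\xi^6,\xi^3,\zeta,\zeta^2,\xi,\xi^{11},\xi^2,\xi^7$. For such a root $a$, the constituent at $a$ of an $\mathbb F_4$-linear code $C\subseteq\mathbb F_4^{30}$ is the $\mathbb F_4(a)$-span of $\{(c_0(a),c_1(a)):\vec c\in C\}$ in $\mathbb F_4(a)^2$. There is exactly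 one $\mathbb F_4$-linear code $C\subseteq\mathbb F_4^{30}$ that is invariant under the cyclic shift by two positions and whose constituents at these nine points are, in this order, generated by $$(0\ 1),\quad 0,\quad (1\ \xi^{10}),\quad (1\ \zeta),\quad (1\ \zeta),\quad (1\ 1),\quad I_2,\quad 0,\quad 0,$$ where $0$ stands for the zero code and $I_2$ for the full space. Let $C^{\perp_{\rm H}}$ be its dual for the Hermitian form $\sum_i v_iu_i^2$. Then: 1. $C$ is quasi-cyclic of index $2$ (two is the least positive number of positions by which its codewords can be cyclically shifted without leaving $C$). Its image in $R^2$ is the $R$-submodule generated by $(f_{1,0},f_{1,1})$ and $(f_{2,0},f_{2,1})$, where $$\begin{aligned}f_{1,0}&=\zeta x^{12}+x^{10}+\zeta^2x^9+\zeta^2x^6+x^5+\zeta x^3,\\ f_{1,1}&=\zeta^2x^{13}+\zeta^2x^{12}+\zeta^2x^{10}+x^9+\zeta^2x^7+x^6+\zeta^2x^5+\zeta x^4+\zeta^2x^3+\zeta x+1,\\ f_{2,0}&=0,\\ f_{2,1}&=\zeta^2x^{14}+\zeta x^{13}+\zeta^2x^{12}+\zeta^2x^{11}+\zeta x^9+x^8+\zeta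 x^7+\zeta x^6+x^4+\zeta^2x^3+x^2+x.\end{aligned}$$ 2. $\dim C=11$ and $\dim(C\cap C^{\perp_{\rm H}})=10$, so the Hermitian hull has codimension $e=1$ in $C$. 3. $C^{\perp_{\rm H}}$ is a $[30,19,7]_4$ code, and $C+C^{\perp_{\rm H}}$ has minimum distance $6$. 4. There exist qubit stabilizer codes with parameters $[\![31,9,7]\!]_2$, $[\![31,8,7]\!]_2$, $[\![32,9,7]\!]_2$ and $[\![30,9,6]\!]_2$. All minimum distances are exact. A qubit stabilizer code $[\![n,k,d]\!]_2$ (with $k\ge1$) is a $2^k$-dimensional subspace of $(\mathbb C^2)^{\otimes n}$ that consists of all vectors fixed by an abelian subgroup of the $n$-qubit Pauli group; $d$ is the smallest weight of a Pauli error $E$ that it does not detect, i.e. for which the compression of $E$ to the code is not a scalar. -/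

import Mathlib

open Polynomial

namespace QubitQC

noncomputable section

/-! ### Linear codes -/

section LinearCodes

variable {F : Type*} [Field F] {ι : Type*} [Fintype ι]

/-- The Hermitian dual of a linear code `C` over a field with `q ^ 2` elements: all `v` such that
`⟨v, u⟩_H = ∑ i, v i * (u i) ^ q` vanishes for every `u ∈ C`. -/
def hermDual (q : ℕ) (C : Submodule F (ι → F)) : Submodule F (ι → F) where
  carrier := {v | ∀ u ∈ C, ∑ i, v i * u i ^ q = 0}
  zero_mem' := by
    intro u _
    simp
  add_mem' := by
    intro v w hv hw u hu
    have h1 := hv u hu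
    have h2 := hw u hu
    simp only [Pi.add_apply, add_mul, Finset.sum_add_distrib, h1, h2, add_zero]
  smul_mem' := by
    intro a v hv u hu
    have h1 := hv u hu
    simp only [Pi.smul_apply, smul_eq_mul, mul_assoc, ← Finset.mul_sum, h1, mul_zero]

/-- `C` has minimum distance exactly `d`: the least Hamming weight of a nonzero codeword. -/
def HasMinDist [DecidableEq F] (C : Submodule F (ι → F)) (d : ℕ) : Prop :=
  IsLeast {w : ℕ | ∃ c ∈ C, c ≠ 0 ∧ hammingNorm c = w} d

/-- `C` is a linear code with parameters `[n, k, d]` over `F`. -/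
def IsLinearCode [DecidableEq F] (n k d : ℕ) (C : Submodule F (ι → F)) : Prop :=
  Fintype.card ι = n ∧ Module.finrank F C = k ∧ HasMinDist C d

end LinearCodes

/-! ### Quasi-cyclic codes and their constituents -/

section QuasiCyclic

variable {F : Type*} [Field F]

/-- `C` is invariant under the cyclic shift of codewords by `s` positions. -/
def ShiftInvariant {n : ℕ} (s : ℕ) (C : Submodule F (Fin n → F)) : Prop :=
  ∀ c ∈ C, (fun i => c ((finRotate n ^ s).symm i)) ∈ C

/-- `C` is quasi-cyclic of index `l`: `l` is the least positive number of positions by which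
the codewords can be shifted without leaving `C`. -/
def IsQuasiCyclic {n : ℕ} (l : ℕ) (C : Submodule F (Fin n → F)) : Prop :=
  IsLeast {s : ℕ | 0 < s ∧ ShiftInvariant s C} l

/-- The entry `c_{g,t}` of the `m × l` array attached to a vector of length `m * l`
(row by row: `c_{g,t}` is the entry in position `g * l + t`). -/
def entry {m l : ℕ} (c : Fin (m * l) → F) (g : Fin m) (t : Fin l) : F :=
  c (finProdFinEquiv (g, t))

/-- For a point `a` of an `F`-algebra `A`, the vector `(c_0(a), …, c_{l-1}(a))`, where
`c_t(x) = ∑ g, c_{g,t} x ^ g`. -/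
def evalAt (m l : ℕ) {A : Type*} [CommRing A] [Algebra F A] (a : A) :
    (Fin (m * l) → F) →ₗ[F] (Fin l → A) where
  toFun c := fun t => ∑ g : Fin m, entry c g t • a ^ (g : ℕ)
  map_add' c d := by
    funext t
    simp only [entry, Pi.add_apply, add_smul, Finset.sum_add_distrib]
  map_smul' r c := by
    funext t
    simp only [entry, Pi.smul_apply, smul_eq_mul, mul_smul, Finset.smul_sum, RingHom.id_apply]

/-- The ring `R = F[x] / ⟨x ^ m - 1⟩`. -/
abbrev cycRing (F : Type*) [Field F] (m : ℕ) : Type _ := AdjoinRoot (X ^ m - 1 : F[X])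

/-- The map `c ↦ (c_0(x), …, c_{l-1}(x))` from `F ^ (m * l)` to `R ^ l`. -/
def polyRep (m l : ℕ) : (Fin (m * l) → F) →ₗ[F] (Fin l → cycRing F m) :=
  evalAt m l (AdjoinRoot.root (X ^ m - 1 : F[X]))

/-- The constituent of `C` at the point `a` of the extension field `A`: the `A`-span of all
evaluations at `a` of the codewords, a linear code of length `l` over `A`. -/
def constituent (m l : ℕ) {A : Type*} [Field A] [Algebra F A] (a : A)
    (C : Submodule F (Fin (m * l) → F)) : Submodule A (Fin l → A) :=
  Submodule.span A (evalAt m l a '' (C : Set (Fin (m * l) → F)))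

end QuasiCyclic

/-! ### The data of the code of length 30 over the field with four elements -/

section Data

variable {F K : Type*} [Field F] [Field K] [Algebra F K]

/-- The nine factors of `x ^ 15 - 1`. -/
def factor (z : F) : Fin 9 → F[X] :=
  ![X + 1, X ^ 2 + C z * X + 1, X ^ 2 + C (z ^ 2) * X + 1, X + C z, X + C (z ^ 2),
    X ^ 2 + X + C z, X ^ 2 + C (z ^ 2) * X + C (z ^ 2),
    X ^ 2 + X + C (z ^ 2), X ^ 2 + C z * X + C z]

/-- A root of each of the nine factors, in the same order. -/
def point (z : F) (x : K) : Fin 9 → K :=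
  ![1, x ^ 6, x ^ 3, algebraMap F K z, algebraMap F K (z ^ 2), x, x ^ 11, x ^ 2, x ^ 7]

/-- The nine constituents, listed along the nine points. Those at `1`, `z` and `z ^ 2` are codes
over `F`, the others are codes over `K`. -/
def HasConstituents (z : F) (x : K) (D : Submodule F (Fin (15 * 2) → F)) : Prop :=
  constituent 15 2 (1 : F) D = Submodule.span F {![0, 1]} ∧
  constituent 15 2 (x ^ 6) D = ⊥ ∧
  constituent 15 2 (x ^ 3) D = Submodule.span K {![1, x ^ 10]} ∧
  constituent 15 2 z D = Submodule.span F {![1, z]} ∧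
  constituent 15 2 (z ^ 2) D = Submodule.span F {![1, z]} ∧
  constituent 15 2 x D = Submodule.span K {![1, 1]} ∧
  constituent 15 2 (x ^ 11) D = ⊤ ∧
  constituent 15 2 (x ^ 2) D = ⊥ ∧
  constituent 15 2 (x ^ 7) D = ⊥

def f10 (z : F) : F[X] :=
  C z * X ^ 12 + X ^ 10 + C (z ^ 2) * X ^ 9 + C (z ^ 2) * X ^ 6 + X ^ 5 + C z * X ^ 3

def f11 (z : F) : F[X] :=
  C (z ^ 2) * X ^ 13 + C (z ^ 2) * X ^ 12 + C (z ^ 2) * X ^ 10 + X ^ 9 + C (z ^ 2) * X ^ 7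
    + X ^ 6 + C (z ^ 2) * X ^ 5 + C z * X ^ 4 + C (z ^ 2) * X ^ 3 + C z * X + 1

def f20 : F[X] := 0

def f21 (z : F) : F[X] :=
  C (z ^ 2) * X ^ 14 + C z * X ^ 13 + C (z ^ 2) * X ^ 12 + C (z ^ 2) * X ^ 11 + C z * X ^ 9
    + X ^ 8 + C z * X ^ 7 + C z * X ^ 6 + X ^ 4 + C (z ^ 2) * X ^ 3 + X ^ 2 + X

/-- The class in `R = F[x] / ⟨x ^ 15 - 1⟩` of a polynomial. -/
def toR (f : F[X]) : cycRing F 15 := AdjoinRoot.mk (X ^ 15 - 1) f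

end Data

/-! ### Qubit stabilizer codes -/

section Quantum

/-- The state space `(ℂ ^ 2) ^ ⊗ n`, with orthonormal basis indexed by the bit strings of
length `n`. -/
abbrev QState (n : ℕ) : Type := EuclideanSpace ℂ (Fin n → ZMod 2)

/-- The error operator `X(a) Z(b)`, sending the basis vector `|y⟩` to `(-1) ^ (b ⬝ y) |y + a⟩`.
It is the tensor product over the sites `i` of the matrices `X ^ (a i) Z ^ (b i)`. -/
def pauliXZ {n : ℕ} (a b : Fin n → ZMod 2) : QState n →ₗ[ℂ] QState n where
  toFun v := WithLp.toLp 2 fun x => (-1 : ℂ) ^ (∑ i, b i * (x - a) i).val * v (x - a)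
  map_add' v w := by
    ext x
    simp [mul_add]
  map_smul' c v := by
    ext x
    simp [mul_left_comm]

/-- The weight of `X(a) Z(b)`: the number of sites on which it acts nontrivially. -/
def pauliWeight {n : ℕ} (a b : Fin n → ZMod 2) : ℕ :=
  (Finset.univ.filter fun i => a i ≠ 0 ∨ b i ≠ 0).card

/-- `Q` is a stabilizer code: a nonzero space that consists of all vectors fixed by an abelian
subgroup of the Pauli group, whose elements are the `i ^ k X(a) Z(b)`. -/
def IsStabilizerCode {n : ℕ} (Q : Submodule ℂ (QState n)) : Prop :=
  Q ≠ ⊥ ∧ ∃ S : Subgroup (QState n ≃ₗ[ℂ] QState n),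
    (∀ g ∈ S, ∃ (k : ℕ) (a b : Fin n → ZMod 2), ∀ v, g v = Complex.I ^ k • pauliXZ a b v) ∧
    (∀ g ∈ S, ∀ h ∈ S, g * h = h * g) ∧
    ∀ v, v ∈ Q ↔ ∀ g ∈ S, g v = v

/-- `Q` detects the error `E`: the compression of `E` to `Q` is a scalar. -/
def Detects {n : ℕ} (Q : Submodule ℂ (QState n)) (E : QState n →ₗ[ℂ] QState n) : Prop :=
  ∃ c : ℂ, ∀ u ∈ Q, ∀ v ∈ Q, inner ℂ u (E v) = c * inner ℂ u v

/-- `Q` has minimum distance exactly `d`: it detects all Pauli errors of weight less than `d`, and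
fails to detect some Pauli error of weight `d`. -/
def HasQuantumDist {n : ℕ} (Q : Submodule ℂ (QState n)) (d : ℕ) : Prop :=
  IsLeast {w : ℕ | ∃ a b : Fin n → ZMod 2, pauliWeight a b = w ∧ ¬ Detects Q (pauliXZ a b)} d

/-- `Q` is a qubit stabilizer code with parameters `[[n, k, d]]` (for `k ≥ 1`). -/
def IsQubitCode (n k d : ℕ) (Q : Submodule ℂ (QState n)) : Prop :=
  IsStabilizerCode Q ∧ Module.finrank ℂ Q = 2 ^ k ∧ HasQuantumDist Q d

end Quantum

end

end QubitQC

open QubitQC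

/-!
The word polynomials `(f10, f11)` and `(f20, f21)` generate a quasi-cyclic code `D`, the code
`theCode`, whose constituents are the spans of the values of the two generators at the nine points
(`constituent_shiftSpan`). These values are computed in the explicit field `GF16`, over the explicit
field `GF4`. Uniqueness is the Chinese remainder theorem (`le_of_hasConstituents`): if two
quasi-cyclic codes have the same constituent at a root of the factor `f`, then for each word `c` of
one code there is a word `d` of the other with the same value there; hence `c - d` is killed by the
cofactor `(x ^ 15 - 1) / f`, which therefore maps `c` into the other code. The cofactors of the nine
pairwise coprime factors generate the unit ideal.

A generator matrix `genRow` of `D` is chosen so that its first ten rows, of the form `(1 | A)`, span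
the Hermitian hull `H`, while the last row `u` has zeros in the first ten positions, is orthogonal
to `H` and has norm `1`. Dimensions can be read off from it. Both distance bounds follow from a
single statement (`seven_le_hammingNorm`): a nonzero word `v` orthogonal to `H` satisfies
`wt v + [⟨v, u⟩ ≠ 0] ≥ 7`. Indeed the last twenty entries of `v` determine the first ten entries and
`⟨v, u⟩`. If `wt v ≤ 6`, one of the shifts of `v` by `0`, `10` or `20` positions has at most four
nonzero entries among the last twenty, because these three windows cover every position twice. So it
is enough to go through all combinations of at most four of twenty columns, which the kernel does on
bit masks (`search_checkColumn`, `le_hammingNorm_of_search`).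

The quantum codes come from isotropic subspaces `S` of the symplectic space of Pauli labels. On such
a subspace the commutation signs are polarized by a `ZMod 4`-valued quadratic function, which yields
phases turning the Pauli operators of `S` into a representation (`exists_phase`, `pauliRep`). Its
fixed space has dimension `2 ^ (n - dim S)` by a trace computation, and a Pauli error is undetected
exactly if its label lies in the symplectic complement of `S` but not in `S`
(`IsAdditiveCode.exists_isQubitCode`). The coefficient of `ω` in the Hermitian form is the
symplectic form, so `H` gives a `[[30, 10, 6]]` code, and the extension of `D` by the symbol
`⟨c, u⟩`, which is self-orthogonal, gives a `[[31, 9, 7]]` code. The other parameters follow by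
passing to a subcode (`IsAdditiveCode.exists_subcode`) or by adding a site
(`IsAdditiveCode.exists_lengthening`).
-/

open QubitQC

namespace QubitQC

/-! ### Pauli operators and the symplectic form -/

/-- The sign character of `ZMod 2` with values in `ℂ`. -/
def sgn (e : ZMod 2) : ℂ := (-1) ^ e.val

theorem sgn_zero : sgn 0 = 1 := by simp [sgn]

theorem sgn_one : sgn 1 = -1 := by simp [sgn, ZMod.val_one]

theorem sgn_add (d e : ZMod 2) : sgn (d + e) = sgn d * sgn e := by
  rw [sgn, sgn, sgn, ← pow_add, ZMod.val_add, ← neg_one_pow_eq_pow_mod_two]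

theorem sgn_mul_self (d : ZMod 2) : sgn d * sgn d = 1 := by
  rw [← sgn_add, CharTwo.add_self_eq_zero, sgn_zero]

theorem star_sgn (d : ZMod 2) : (starRingEnd ℂ) (sgn d) = sgn d := by
  simp [sgn]

/-- Pairs of binary vectors, labelling the Pauli operators up to phase. -/
abbrev PauliLabel (n : ℕ) : Type := (Fin n → ZMod 2) × (Fin n → ZMod 2)

/-- The operator `X(a) Z(b)` attached to the label `(a, b)`. -/
noncomputable abbrev pauliOp {n : ℕ} (s : PauliLabel n) : QState n →ₗ[ℂ] QState n :=
  pauliXZ s.1 s.2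

/-- The bilinear form `b ⬝ a'`, the sign in the product of two Pauli operators. -/
def zxForm {n : ℕ} : PauliLabel n →ₗ[ZMod 2] PauliLabel n →ₗ[ZMod 2] ZMod 2 :=
  LinearMap.mk₂ (ZMod 2) (fun s t => ∑ i, s.2 i * t.1 i)
    (by intros; simp [add_mul, Finset.sum_add_distrib])
    (by intros; simp [Finset.mul_sum, mul_assoc])
    (by intros; simp [mul_add, Finset.sum_add_distrib])
    (by intros; simp [Finset.mul_sum, mul_left_comm])

theorem zxForm_apply {n : ℕ} (s t : PauliLabel n) : zxForm s t = ∑ i, s.2 i * t.1 i := rfl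

/-- The symplectic form, which tells whether two Pauli operators commute. -/
def symp {n : ℕ} : LinearMap.BilinForm (ZMod 2) (PauliLabel n) := zxForm + zxForm.flip

theorem symp_apply {n : ℕ} (s t : PauliLabel n) : symp s t = zxForm s t + zxForm t s := rfl

theorem symp_comm {n : ℕ} (s t : PauliLabel n) : symp s t = symp t s := by
  rw [symp_apply, symp_apply, add_comm]

theorem symp_self {n : ℕ} (s : PauliLabel n) : symp s s = 0 := by
  rw [symp_apply, CharTwo.add_self_eq_zero]

theorem symp_isRefl {n : ℕ} : (symp (n := n)).IsRefl := fun s t h => by rw [symp_comm, h]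

theorem exists_symp_ne_zero {n : ℕ} {s : PauliLabel n} (hs : s ≠ 0) : ∃ t, symp s t ≠ 0 := by
  by_contra! h
  apply hs
  ext i
  · have := h (0, Pi.single i 1)
    simpa [symp_apply, zxForm_apply, Pi.single_apply] using this
  · have := h (Pi.single i 1, 0)
    simpa [symp_apply, zxForm_apply, Pi.single_apply] using this

theorem symp_nondegenerate {n : ℕ} : (symp (n := n)).Nondegenerate := by
  refine (LinearMap.IsRefl.nondegenerate_iff_separatingLeft symp_isRefl).2 ?_
  intro s h
  by_contra hs
  obtain ⟨t, ht⟩ := exists_symp_ne_zero hs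
  exact ht (h t)

theorem pauliXZ_apply {n : ℕ} (a b : Fin n → ZMod 2) (v : QState n) (x : Fin n → ZMod 2) :
    pauliXZ a b v x = sgn (∑ i, b i * (x - a) i) * v (x - a) := rfl

theorem pauliOp_zero {n : ℕ} : pauliOp (0 : PauliLabel n) = 1 := by
  ext v x
  simp [pauliXZ_apply, sgn_zero]

theorem pauliOp_mul {n : ℕ} (s t : PauliLabel n) :
    pauliOp s * pauliOp t = sgn (zxForm s t) • pauliOp (s + t) := by
  ext v x
  simp only [Module.End.mul_apply, pauliXZ_apply, LinearMap.smul_apply, PiLp.smul_apply,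
    smul_eq_mul, Prod.fst_add, Prod.snd_add, ← mul_assoc, ← sgn_add, zxForm_apply, sub_sub]
  congr 2
  simp only [← Finset.sum_add_distrib, Pi.add_apply, Pi.sub_apply]
  refine Finset.sum_congr rfl fun i _ => ?_
  ring

theorem pauliOp_mul_comm {n : ℕ} (s t : PauliLabel n) :
    pauliOp s * pauliOp t = sgn (symp s t) • (pauliOp t * pauliOp s) := by
  rw [pauliOp_mul, pauliOp_mul, smul_smul, symp_apply, sgn_add, mul_assoc, sgn_mul_self, mul_one,
    add_comm]

theorem inner_pauliOp {n : ℕ} (s : PauliLabel n) (u v : QState n) :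
    inner ℂ (pauliOp s u) (pauliOp s v) = inner ℂ u v := by
  simp only [PiLp.inner_apply, pauliXZ_apply, RCLike.inner_apply, map_mul, star_sgn]
  rw [← Equiv.sum_comp (Equiv.subRight s.1) (fun x => v x * (starRingEnd ℂ) (u x))]
  refine Finset.sum_congr rfl fun x _ => ?_
  simp only [Equiv.subRight_apply]
  linear_combination (v (x - s.1) * (starRingEnd ℂ) (u (x - s.1))) *
    sgn_mul_self (∑ i, s.2 i * (x - s.1) i)

/-- A Pauli operator with nonzero label is conjugate to its negative, by a Pauli operator that
anticommutes with it. -/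
theorem trace_pauliOp {n : ℕ} {s : PauliLabel n} (hs : s ≠ 0) :
    LinearMap.trace ℂ (QState n) (pauliOp s) = 0 := by
  obtain ⟨t, ht⟩ := exists_symp_ne_zero hs
  have h1 : symp s t = 1 := by
    generalize symp s t = e at ht
    fin_cases e
    · exact absurd rfl ht
    · rfl
  have h2 : pauliOp t * pauliOp t = sgn (zxForm t t) • 1 := by
    rw [pauliOp_mul, ZModModule.add_self, pauliOp_zero]
  have h3 := congrArg (fun f => LinearMap.trace ℂ (QState n) (f * pauliOp t))
    (pauliOp_mul_comm s t)
  simp only [h1, sgn_one, smul_mul_assoc, map_smul] at h3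
  rw [LinearMap.trace_mul_cycle ℂ (pauliOp t), mul_assoc, h2, smul_mul_assoc, one_mul,
    mul_smul_comm, mul_one, map_smul, smul_eq_mul, smul_eq_mul] at h3
  have h4 := sgn_mul_self (zxForm t t)
  have h5 : sgn (zxForm t t) ≠ 0 := by
    intro h
    rw [h, zero_mul] at h4
    exact zero_ne_one h4
  have h6 : sgn (zxForm t t) * LinearMap.trace ℂ (QState n) (pauliOp s) = 0 := by
    linear_combination (1 / 2 : ℂ) * h3
  exact (mul_eq_zero.1 h6).resolve_left h5

/-! ### A choice of phases -/

/-- The lift of a bit to `ZMod 4`. -/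
def bitLift (e : ZMod 2) : ZMod 4 := (e.val : ZMod 4)

theorem exists_bitLift_add (d e : ZMod 2) :
    ∃ m, bitLift (d + e) = bitLift d + bitLift e + 2 * m := by
  revert d e
  decide

/-- Twice the lift of a bit, as a homomorphism. -/
def twiceLift : ZMod 2 →+ ZMod 4 where
  toFun e := 2 * bitLift e
  map_zero' := by decide
  map_add' := by decide

theorem twiceLift_mul (d e : ZMod 2) : twiceLift (d * e) = bitLift d * twiceLift e := by
  revert d e
  decide

theorem I_pow_val_add (d e : ZMod 4) :
    Complex.I ^ (d + e).val = Complex.I ^ d.val * Complex.I ^ e.val := by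
  rw [← pow_add, ZMod.val_add]
  exact (Complex.I_pow_eq_pow_mod _).symm

theorem I_pow_twiceLift (e : ZMod 2) : Complex.I ^ (twiceLift e).val = sgn e := by
  fin_cases e
  · change Complex.I ^ 0 = sgn 0
    simp [sgn_zero]
  · change Complex.I ^ 2 = sgn 1
    simp [sgn_one]

/-- A symmetric bilinear form `B` over `ZMod 2` is the polarization of a `ZMod 4`-valued
quadratic function `Q`, obtained by lifting a Gram matrix to `ZMod 4`. The phases are the powers
`I ^ Q`. -/
theorem exists_phase {W : Type*} [AddCommGroup W] [Module (ZMod 2) W] [Module.Finite (ZMod 2) W]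
    (B : W →ₗ[ZMod 2] W →ₗ[ZMod 2] ZMod 2) (hB : ∀ s t, B s t = B t s) :
    ∃ q : W → ℕ, ∀ s t,
      Complex.I ^ q (s + t) = Complex.I ^ q s * Complex.I ^ q t * sgn (B s t) := by
  let b := Module.finBasis (ZMod 2) W
  let M := fun i j => bitLift (B (b i) (b j))
  have hM : ∀ i j, M i j = M j i := fun i j => by simp only [M, hB (b i)]
  let x := fun (s : W) i => bitLift (b.repr s i)
  let Q : W → ZMod 4 := fun s => ∑ i, ∑ j, x s i * x s j * M i j
  have hpol : ∀ s t, twiceLift (B s t) = ∑ i, ∑ j, 2 * (x s i * x t j * M i j) := by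
    intro s t
    conv_lhs => rw [← b.sum_repr s, ← b.sum_repr t]
    simp only [map_sum, map_smul, LinearMap.sum_apply, LinearMap.smul_apply, smul_eq_mul,
      twiceLift_mul, Finset.mul_sum]
    rw [Finset.sum_comm]
    refine Finset.sum_congr rfl fun i _ => Finset.sum_congr rfl fun j _ => ?_
    change _ * (_ * (2 * bitLift _)) = _
    simp only [x, M]
    ring
  have key : ∀ s t, Q (s + t) = Q s + Q t + twiceLift (B s t) := by
    intro s t
    choose m hm using fun i => exists_bitLift_add (b.repr s i) (b.repr t i)
    have hx : ∀ i, x (s + t) i = x s i + x t i + 2 * m i := fun i => by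
      simp only [x, map_add, Finsupp.add_apply, hm]
    have hswap : ∀ f g : Fin (Module.finrank (ZMod 2) W) → ZMod 4,
        ∑ i, ∑ j, f i * g j * M i j = ∑ i, ∑ j, g i * f j * M i j := by
      intro f g
      rw [Finset.sum_comm]
      refine Finset.sum_congr rfl fun i _ => Finset.sum_congr rfl fun j _ => ?_
      rw [hM j i]
      ring
    have four : (4 : ZMod 4) = 0 := rfl
    have h1 := hswap (x t) (x s)
    have h2 := hswap m (fun i => x s i + x t i)
    have e : Q (s + t) = Q s + Q t + ∑ i, ∑ j, x s i * x t j * M i j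
        + ∑ i, ∑ j, x t i * x s j * M i j + 2 * ∑ i, ∑ j, m i * (x s j + x t j) * M i j
        + 2 * ∑ i, ∑ j, (x s i + x t i) * m j * M i j := by
      simp only [Q, hx, Finset.mul_sum, ← Finset.sum_add_distrib]
      refine Finset.sum_congr rfl fun i _ => Finset.sum_congr rfl fun j _ => ?_
      linear_combination m i * m j * M i j * four
    rw [e, hpol, h1, h2]
    simp only [← Finset.mul_sum]
    linear_combination (∑ i, ∑ j, (x s i + x t i) * m j * M i j) * four
  refine ⟨fun s => (Q s).val, fun s t => ?_⟩
  simp only [key]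
  rw [I_pow_val_add, I_pow_val_add, I_pow_twiceLift]

/-! ### Stabilizer codes from isotropic subspaces -/

/-- The number of sites on which a Pauli label is nontrivial. -/
abbrev labelWeight {n : ℕ} (s : PauliLabel n) : ℕ := pauliWeight s.1 s.2

/-- `S` is an isotropic subspace of dimension `n - k`, and the least weight of a label in its
symplectic complement outside `S` is `d`. -/
structure IsAdditiveCode (n k d : ℕ) (S : Submodule (ZMod 2) (PauliLabel n)) : Prop where
  isotropic : ∀ s ∈ S, ∀ t ∈ S, symp s t = 0
  finrank_add : Module.finrank (ZMod 2) S + k = n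
  isLeast : IsLeast {w | ∃ e, (∀ s ∈ S, symp s e = 0) ∧ e ∉ S ∧ labelWeight e = w} d

section Representation

variable {n : ℕ} (S : Submodule (ZMod 2) (PauliLabel n)) (q : S → ℕ)

theorem phase_zero (hq : ∀ s t, Complex.I ^ q (s + t) =
    Complex.I ^ q s * Complex.I ^ q t * sgn (zxForm (s : PauliLabel n) t)) :
    Complex.I ^ q 0 = 1 := by
  have h := hq 0 0
  simp only [add_zero, ZeroMemClass.coe_zero, map_zero, sgn_zero, mul_one] at h
  have h0 : Complex.I ^ q 0 ≠ 0 := pow_ne_zero _ Complex.I_ne_zero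
  exact (mul_right_cancel₀ h0 (by rw [one_mul]; exact h)).symm

variable (hq : ∀ s t, Complex.I ^ q (s + t) =
    Complex.I ^ q s * Complex.I ^ q t * sgn (zxForm (s : PauliLabel n) t))

/-- The representation of an isotropic space of labels by Pauli operators, for a choice of
phases. -/
noncomputable def pauliRep : Representation ℂ (Multiplicative S) (QState n) where
  toFun s := Complex.I ^ q s.toAdd • pauliOp (s.toAdd : PauliLabel n)
  map_one' := by
    rw [toAdd_one, phase_zero S q hq, one_smul, ZeroMemClass.coe_zero, pauliOp_zero]
  map_mul' s t := by
    rw [toAdd_mul, hq, smul_mul_smul_comm, pauliOp_mul, smul_smul, Submodule.coe_add]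

theorem pauliRep_apply (s : Multiplicative S) :
    pauliRep S q hq s = Complex.I ^ q s.toAdd • pauliOp (s.toAdd : PauliLabel n) := rfl

/-- The trace of a Pauli operator times the average of the stabilizer vanishes, unless the operator
is in the stabilizer up to a phase. -/
theorem trace_pauliOp_mul_averageMap [Fintype (Multiplicative S)]
    [Invertible (Fintype.card (Multiplicative S) : ℂ)] {e : PauliLabel n} (he : e ∉ S) :
    LinearMap.trace ℂ (QState n) (pauliOp e * (pauliRep S q hq).averageMap) = 0 := by
  rw [Representation.averageMap, GroupAlgebra.average]
  simp only [map_smul, map_sum, Representation.asAlgebraHom_of, mul_smul_comm, Finset.mul_sum]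
  rw [Finset.sum_eq_zero, smul_zero]
  intro s _
  rw [pauliRep_apply, mul_smul_comm, pauliOp_mul, map_smul, map_smul, trace_pauliOp, smul_zero,
    smul_zero]
  intro h
  apply he
  rw [eq_neg_of_add_eq_zero_left h]
  exact S.neg_mem s.toAdd.2

theorem finrank_invariants_pauliRep {k : ℕ} (hk : Module.finrank (ZMod 2) S + k = n) :
    Module.finrank ℂ (pauliRep S q hq).invariants = 2 ^ k := by
  classical
  have : Fintype (Multiplicative S) := Fintype.ofFinite _
  have hcard : Fintype.card (Multiplicative S) = 2 ^ Module.finrank (ZMod 2) S := by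
    rw [← Nat.card_eq_fintype_card, Nat.card_congr Multiplicative.toAdd,
      Module.natCard_eq_pow_finrank (K := ZMod 2), Nat.card_zmod]
  have hne : (Fintype.card (Multiplicative S) : ℂ) ≠ 0 := by
    rw [hcard, Nat.cast_pow]
    exact pow_ne_zero _ (by norm_num)
  have := invertibleOfNonzero hne
  have h1 := ((pauliRep S q hq).isProj_averageMap).trace
  have h2 : (Fintype.card (Multiplicative S) : ℂ) *
      LinearMap.trace ℂ (QState n) (pauliRep S q hq).averageMap = 2 ^ n := by
    rw [Representation.averageMap, GroupAlgebra.average]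
    simp only [map_smul, map_sum, Representation.asAlgebraHom_of]
    rw [smul_eq_mul, mul_invOf_cancel_left', Finset.sum_eq_single 1]
    · rw [map_one, LinearMap.trace_one, finrank_euclideanSpace]
      simp [ZMod.card]
    · intro s _ hs
      rw [pauliRep_apply, map_smul, trace_pauliOp, smul_zero]
      intro h
      exact hs (Multiplicative.toAdd.injective (Subtype.ext h))
    · simp
  rw [h1, hcard] at h2
  have h3 : 2 ^ Module.finrank (ZMod 2) S * Module.finrank ℂ (pauliRep S q hq).invariants
      = 2 ^ Module.finrank (ZMod 2) S * 2 ^ k := by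
    rw [← pow_add, hk]
    exact_mod_cast h2
  exact Nat.eq_of_mul_eq_mul_left (by positivity) h3

theorem isStabilizerCode_invariants (h0 : (pauliRep S q hq).invariants ≠ ⊥) :
    IsStabilizerCode (pauliRep S q hq).invariants := by
  let f := (LinearMap.GeneralLinearGroup.generalLinearEquiv ℂ (QState n)).toMonoidHom.comp
    (pauliRep S q hq).toHomUnits
  have hf : ∀ s v, f s v = pauliRep S q hq s v := fun s v => rfl
  refine ⟨h0, f.range, ?_, ?_, ?_⟩
  · rintro _ ⟨s, rfl⟩
    exact ⟨q s.toAdd, _, _, fun v => hf s v⟩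
  · rintro _ ⟨s, rfl⟩ _ ⟨t, rfl⟩
    rw [← map_mul, mul_comm, map_mul]
  · intro v
    rw [Representation.mem_invariants]
    constructor
    · rintro h _ ⟨s, rfl⟩
      exact h s
    · exact fun h s => h (f s) ⟨s, rfl⟩

theorem detects_of_mem {e : PauliLabel n} (he : e ∈ S) :
    Detects (pauliRep S q hq).invariants (pauliOp e) := by
  have h0 : Complex.I ^ q ⟨e, he⟩ ≠ 0 := pow_ne_zero _ Complex.I_ne_zero
  refine ⟨(Complex.I ^ q ⟨e, he⟩)⁻¹, fun u _ v hv => ?_⟩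
  have h := hv (Multiplicative.ofAdd ⟨e, he⟩)
  have h' : Complex.I ^ q ⟨e, he⟩ • pauliOp e v = v := h
  rw [← inner_smul_right]
  congr 1
  rw [eq_inv_smul_iff₀ h0, h']

/-- An error that anticommutes with some `g` in the stabilizer has zero compression, as
`⟨u, E v⟩ = ⟨g u, E g v⟩ = - ⟨g u, g E v⟩ = - ⟨u, E v⟩`. -/
theorem detects_of_symp_ne_zero {e s : PauliLabel n} (hs : s ∈ S) (he : symp s e ≠ 0) :
    Detects (pauliRep S q hq).invariants (pauliOp e) := by
  refine ⟨0, fun u hu v hv => ?_⟩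
  let c := Complex.I ^ q ⟨s, hs⟩
  have hu' : c • pauliOp s u = u := hu (Multiplicative.ofAdd ⟨s, hs⟩)
  have hv' : c • pauliOp s v = v := hv (Multiplicative.ofAdd ⟨s, hs⟩)
  have hc : (starRingEnd ℂ) c * c = 1 := by
    rw [← Complex.normSq_eq_conj_mul_self, Complex.normSq_eq_norm_sq]
    simp [c]
  have h1 : sgn (symp e s) = -1 := by
    rw [symp_comm]
    generalize symp s e = x at he
    fin_cases x
    · exact absurd rfl he
    · exact sgn_one
  have h2 : pauliOp e (pauliOp s v) = - pauliOp s (pauliOp e v) := by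
    have := congrArg (fun f => f v) (pauliOp_mul_comm e s)
    simpa [h1] using this
  have h3 : inner ℂ u (pauliOp e v) = - inner ℂ u (pauliOp e v) := by
    calc inner ℂ u (pauliOp e v) = inner ℂ (c • pauliOp s u) (pauliOp e (c • pauliOp s v)) := by
          rw [hu', hv']
      _ = ((starRingEnd ℂ) c * c) * inner ℂ (pauliOp s u) (pauliOp e (pauliOp s v)) := by
          rw [map_smul, inner_smul_left, inner_smul_right, mul_assoc]
      _ = - inner ℂ u (pauliOp e v) := by
          rw [hc, one_mul, h2, inner_neg_right, inner_pauliOp]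
  rw [zero_mul]
  exact self_eq_neg.1 h3

/-- If the compression of a normalizer element `E` is the scalar `c`, then `E P = c P` for the
projection `P` to the code; if `E` is outside the stabilizer, taking traces gives `c = 0`, so that
`P = 0`. -/
theorem not_detects {e : PauliLabel n} (h0 : (pauliRep S q hq).invariants ≠ ⊥)
    (hcomm : ∀ s ∈ S, symp s e = 0) (he : e ∉ S) :
    ¬ Detects (pauliRep S q hq).invariants (pauliOp e) := by
  rintro ⟨c, hc⟩
  classical
  have : Fintype (Multiplicative S) := Fintype.ofFinite _
  have := invertibleOfNonzero (Nat.cast_ne_zero.2 (Fintype.card_ne_zero (α := Multiplicative S)) :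
    (Fintype.card (Multiplicative S) : ℂ) ≠ 0)
  set Q := (pauliRep S q hq).invariants with hQ
  have hproj := (pauliRep S q hq).isProj_averageMap
  have hEQ : ∀ v ∈ Q, pauliOp e v ∈ Q := by
    intro v hv s
    have h1 := congrArg (fun f => f v) (pauliOp_mul_comm (s.toAdd : PauliLabel n) e)
    simp only [hcomm _ s.toAdd.2, sgn_zero, one_smul, Module.End.mul_apply] at h1
    have h2 : Complex.I ^ q s.toAdd • pauliOp (s.toAdd : PauliLabel n) v = v := hv s
    rw [pauliRep_apply, LinearMap.smul_apply, h1, ← map_smul, h2]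
  have hscal : ∀ v ∈ Q, pauliOp e v = c • v := by
    intro v hv
    rw [← sub_eq_zero, ← inner_self_eq_zero (𝕜 := ℂ)]
    have hmem : pauliOp e v - c • v ∈ Q := Q.sub_mem (hEQ v hv) (Q.smul_mem c hv)
    conv_lhs => rw [inner_sub_right, inner_smul_right, hc _ hmem _ hv, sub_self]
  have hEP : pauliOp e * (pauliRep S q hq).averageMap = c • (pauliRep S q hq).averageMap := by
    ext1 v
    exact hscal _ (hproj.map_mem v)
  have htr := trace_pauliOp_mul_averageMap S q hq he
  rw [hEP, map_smul, hproj.trace, smul_eq_mul, mul_eq_zero, Nat.cast_eq_zero,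
    Submodule.finrank_eq_zero] at htr
  have hc0 : c = 0 := htr.resolve_right h0
  obtain ⟨v, hv, hv0⟩ := Submodule.exists_mem_ne_zero_of_ne_bot h0
  have h1 := inner_pauliOp e v v
  rw [hscal v hv, hc0, zero_smul, inner_zero_left] at h1
  exact hv0 (inner_self_eq_zero.1 h1.symm)

end Representation

/-- The quantum code is the fixed space of the Pauli operators with labels in `S`, taken with
suitable phases. -/
theorem IsAdditiveCode.exists_isQubitCode {n k d : ℕ} {S : Submodule (ZMod 2) (PauliLabel n)}
    (hS : IsAdditiveCode n k d S) : ∃ Q : Submodule ℂ (QState n), IsQubitCode n k d Q := by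
  obtain ⟨q, hq⟩ := exists_phase ((zxForm (n := n)).domRestrict₁₂ S S) fun s t => by
    have h := hS.isotropic s s.2 t t.2
    rw [symp_apply, CharTwo.add_eq_zero] at h
    exact h
  have hq' : ∀ s t : S, Complex.I ^ q (s + t) =
      Complex.I ^ q s * Complex.I ^ q t * sgn (zxForm (s : PauliLabel n) t) := hq
  have hrank := finrank_invariants_pauliRep S q hq' hS.finrank_add
  have h0 : (pauliRep S q hq').invariants ≠ ⊥ := by
    intro h
    rw [h, finrank_bot] at hrank
    exact absurd hrank.symm (by positivity)
  refine ⟨(pauliRep S q hq').invariants, isStabilizerCode_invariants S q hq' h0, hrank, ?_⟩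
  have hset : {w : ℕ | ∃ a b : Fin n → ZMod 2, pauliWeight a b = w ∧
        ¬ Detects (pauliRep S q hq').invariants (pauliXZ a b)} =
      {w | ∃ e, (∀ s ∈ S, symp s e = 0) ∧ e ∉ S ∧ labelWeight e = w} := ?_
  · rw [HasQuantumDist, hset]
    exact hS.isLeast
  ext w
  constructor
  · rintro ⟨a, b, hw, hdet⟩
    refine ⟨(a, b), ?_, ?_, hw⟩
    · intro s hs
      by_contra h
      exact hdet (detects_of_symp_ne_zero (e := (a, b)) S q hq' hs h)
    · exact fun h => hdet (detects_of_mem (e := (a, b)) S q hq' h)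
  · rintro ⟨e, hcomm, he, hw⟩
    exact ⟨e.1, e.2, hw, not_detects (e := e) S q hq' h0 hcomm he⟩

/-- Adding a suitable normalizer element `v` to the stabilizer: it has to commute with an
undetected error `e` of least weight, so that `e` stays in the normalizer, and it has to lie
outside `S + ⟨e⟩`, so that `e` stays outside the stabilizer. -/
theorem IsAdditiveCode.exists_subcode {n k d : ℕ} {S : Submodule (ZMod 2) (PauliLabel n)}
    (hS : IsAdditiveCode n (k + 1) d S) (hk : 1 ≤ k) : ∃ S', IsAdditiveCode n k d S' := by
  obtain ⟨⟨e, hcomm, he, hw⟩, hle⟩ := hS.isLeast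
  have hrank := hS.finrank_add
  set U := S ⊔ Submodule.span (ZMod 2) {e} with hU
  have hUrank : Module.finrank (ZMod 2) U = Module.finrank (ZMod 2) S + 1 :=
    Submodule.finrank_sup_span_singleton he
  have horth := LinearMap.BilinForm.finrank_orthogonal symp_nondegenerate U
  have hdim : Module.finrank (ZMod 2) (PauliLabel n) = n + n := by simp
  obtain ⟨v, hv, hvU⟩ : ∃ v ∈ symp.orthogonal U, v ∉ U := by
    by_contra! h
    have := Submodule.finrank_mono (show symp.orthogonal U ≤ U from h)
    omega
  have hvS : ∀ s ∈ S, symp s v = 0 := fun s hs => hv s (Submodule.mem_sup_left hs)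
  have hve : symp e v = 0 := hv e (Submodule.mem_sup_right (Submodule.mem_span_singleton_self e))
  have hmem : ∀ s, s ∈ S ⊔ Submodule.span (ZMod 2) {v} ↔ ∃ t ∈ S, ∃ c : ZMod 2, t + c • v = s := by
    intro s
    simp only [Submodule.mem_sup, Submodule.mem_span_singleton]
    constructor
    · rintro ⟨t, ht, _, ⟨c, rfl⟩, h⟩
      exact ⟨t, ht, c, h⟩
    · rintro ⟨t, ht, c, h⟩
      exact ⟨t, ht, _, ⟨c, rfl⟩, h⟩
  refine ⟨S ⊔ Submodule.span (ZMod 2) {v}, ?_, ?_, ?_, ?_⟩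
  · intro s₀ hs₀ t₀ ht₀
    obtain ⟨s, hs, c, rfl⟩ := (hmem s₀).1 hs₀
    obtain ⟨t, ht, c', rfl⟩ := (hmem t₀).1 ht₀
    simp only [map_add, LinearMap.add_apply, map_smul, LinearMap.smul_apply, hS.isotropic s hs t ht,
      hvS s hs, symp_comm v t, hvS t ht, symp_self, smul_zero, add_zero]
  · rw [Submodule.finrank_sup_span_singleton fun h => hvU (Submodule.mem_sup_left h)]
    omega
  · refine ⟨e, ?_, ?_, hw⟩
    · intro s hs
      obtain ⟨t, ht, c, rfl⟩ := (hmem s).1 hs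
      rw [map_add, LinearMap.add_apply, map_smul, LinearMap.smul_apply, hcomm t ht, symp_comm v e,
        hve, smul_zero, add_zero]
    · intro h
      obtain ⟨t, ht, c, h⟩ := (hmem e).1 h
      fin_cases c
      · apply he
        rw [← h]
        change t + (0 : ZMod 2) • v ∈ S
        rwa [zero_smul, add_zero]
      · apply hvU
        have h' : t + (1 : ZMod 2) • v = e := h
        rw [one_smul] at h'
        rw [← sub_eq_of_eq_add' h'.symm]
        exact U.sub_mem (Submodule.mem_sup_right (Submodule.mem_span_singleton_self e))
          (Submodule.mem_sup_left ht)
  · rintro w ⟨f, hf, hfS, rfl⟩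
    exact hle ⟨f, fun s hs => hf s (Submodule.mem_sup_left hs),
      fun h => hfS (Submodule.mem_sup_left h), rfl⟩

/-- Putting the label `(a, c)` of one more site in front of a label. -/
def consLabel {n : ℕ} (a c : ZMod 2) (s : PauliLabel n) : PauliLabel (n + 1) :=
  (Fin.cons a s.1, Fin.cons c s.2)

theorem exists_eq_consLabel {n : ℕ} (e : PauliLabel (n + 1)) : ∃ a c s, e = consLabel a c s :=
  ⟨e.1 0, e.2 0, (Fin.tail e.1, Fin.tail e.2), by simp [consLabel]⟩

theorem symp_consLabel {n : ℕ} (a c a' c' : ZMod 2) (s t : PauliLabel n) :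
    symp (consLabel a c s) (consLabel a' c' t) = c * a' + c' * a + symp s t := by
  simp only [symp_apply, zxForm_apply, consLabel, Fin.sum_univ_succ, Fin.cons_zero, Fin.cons_succ]
  ring

theorem labelWeight_consLabel {n : ℕ} (a c : ZMod 2) (s : PauliLabel n) :
    labelWeight (consLabel a c s) = (if a ≠ 0 ∨ c ≠ 0 then 1 else 0) + labelWeight s := by
  rw [labelWeight, pauliWeight, Fin.card_filter_univ_succ']
  simp [consLabel, labelWeight, pauliWeight]

/-- Adding a site, fixed by its operator `Z`. -/
theorem IsAdditiveCode.exists_lengthening {n k d : ℕ} {S : Submodule (ZMod 2) (PauliLabel n)}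
    (hS : IsAdditiveCode n k d S) : ∃ S', IsAdditiveCode (n + 1) k d S' := by
  obtain ⟨⟨e, hcomm, he, hw⟩, hle⟩ := hS.isLeast
  let f : S × ZMod 2 →ₗ[ZMod 2] PauliLabel (n + 1) :=
    { toFun := fun p => consLabel 0 p.2 p.1
      map_add' := by
        intro p q
        ext i <;> refine Fin.cases ?_ (fun j => ?_) i <;> simp [consLabel]
      map_smul' := by
        intro c p
        ext i <;> refine Fin.cases ?_ (fun j => ?_) i <;> simp [consLabel] }
  have hf : ∀ p, f p = consLabel 0 p.2 p.1 := fun _ => rfl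
  have hinj : ∀ (c c' : ZMod 2) (s t : PauliLabel n), consLabel 0 c s = consLabel 0 c' t →
      c = c' ∧ s = t := by
    intro c c' s t h
    simp only [consLabel, Prod.mk.injEq, Fin.cons_inj] at h
    exact ⟨h.2.1, Prod.ext h.1.2 h.2.2⟩
  refine ⟨LinearMap.range f, ?_, ?_, ?_, ?_⟩
  · rintro _ ⟨p, rfl⟩ _ ⟨q, rfl⟩
    rw [hf, hf, symp_consLabel, hS.isotropic _ p.1.2 _ q.1.2]
    ring
  · rw [LinearMap.finrank_range_of_inj, Module.finrank_prod, Module.finrank_self]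
    · have := hS.finrank_add
      omega
    · intro p q h
      obtain ⟨h1, h2⟩ := hinj _ _ _ _ h
      exact Prod.ext (Subtype.ext h2) h1
  · refine ⟨consLabel 0 0 e, ?_, ?_, ?_⟩
    · rintro _ ⟨p, rfl⟩
      rw [hf, symp_consLabel, hcomm _ p.1.2]
      ring
    · rintro ⟨p, hp⟩
      apply he
      rw [← (hinj _ _ _ _ hp).2]
      exact p.1.2
    · rw [labelWeight_consLabel, hw]
      simp
  · rintro w ⟨g, hg, hgS, rfl⟩
    obtain ⟨a, c, s, rfl⟩ := exists_eq_consLabel g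
    have ha : a = 0 := by
      have := hg _ ⟨(0, 1), rfl⟩
      rw [hf, symp_consLabel] at this
      simpa using this
    subst ha
    rw [labelWeight_consLabel]
    refine le_add_left (hle ⟨s, ?_, ?_, rfl⟩)
    · intro t ht
      have := hg _ ⟨(⟨t, ht⟩, 0), rfl⟩
      rw [hf, symp_consLabel] at this
      simpa using this
    · exact fun h => hgS ⟨(⟨s, h⟩, c), rfl⟩

/-! ### Explicit fields with four and with sixteen elements -/

/-- The field with four elements, as `𝔽₂[ω]` with `ω ^ 2 = 1 + ω`. -/
abbrev GF4 : Type := QuadraticAlgebra (ZMod 2) 1 1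

namespace GF4

/-- The generator `ω` of `GF4`. -/
def w : GF4 := ⟨0, 1⟩

instance : Fintype GF4 := Fintype.ofEquiv _ (QuadraticAlgebra.equivProd 1 1).symm

instance : CharP GF4 2 := CharTwo.of_one_ne_zero_of_two_eq_zero (by decide) (by decide)

end GF4

/-- The field with sixteen elements, as `GF4[ξ]` with `ξ ^ 2 = ω + ξ`. -/
abbrev GF16 : Type := QuadraticAlgebra GF4 GF4.w 1

section QuadHom

variable {R A : Type*} [CommRing R] [CommRing A] (f : R →+* A)

/-- The extension of a ring homomorphism to a quadratic algebra, given the image of the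
generator. -/
def quadHom {a b : R} (u : A) (hu : u * u = f a + f b * u) : QuadraticAlgebra R a b →+* A where
  toFun y := f y.re + f y.im * u
  map_zero' := by simp
  map_one' := by simp [QuadraticAlgebra.re_one, QuadraticAlgebra.im_one]
  map_add' y y' := by
    simp only [QuadraticAlgebra.re_add, QuadraticAlgebra.im_add, map_add]
    ring
  map_mul' y y' := by
    simp only [QuadraticAlgebra.re_mul, QuadraticAlgebra.im_mul, map_add, map_mul]
    linear_combination -(f y.im * f y'.im) * hu

theorem quadHom_apply {a b : R} (u : A) (hu : u * u = f a + f b * u)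
    (y : QuadraticAlgebra R a b) : quadHom f u hu y = f y.re + f y.im * u := rfl

end QuadHom

section Field

variable {F : Type*} [Field F]

theorem charP_two_of_card (hF : Nat.card F = 4) : CharP F 2 := by
  have : Finite F := Nat.finite_of_card_ne_zero (by omega)
  have := Fintype.ofFinite F
  have h4 : ((Fintype.card F : ℕ) : F) = 0 := FiniteField.cast_card_eq_zero F
  rw [← Nat.card_eq_fintype_card, hF] at h4
  have h2 : (2 : F) * 2 = 0 := by
    rw [← h4]
    norm_num
  exact CharTwo.of_one_ne_zero_of_two_eq_zero one_ne_zero (mul_self_eq_zero.1 h2)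

theorem primitive_cube_root {z : F} (hz : IsPrimitiveRoot z 3) : z ^ 2 + z + 1 = 0 := by
  have h1 : z ^ 3 = 1 := hz.pow_eq_one
  have h2 : z - 1 ≠ 0 := sub_ne_zero.2 (hz.ne_one (by norm_num))
  have h3 : (z - 1) * (z ^ 2 + z + 1) = 0 := by linear_combination h1
  exact (mul_eq_zero.1 h3).resolve_left h2

/-- A field with four elements is isomorphic to `GF4`. -/
theorem exists_gf4_equiv (hF : Nat.card F = 4) {z : F} (hz : IsPrimitiveRoot z 3) :
    ∃ φ : GF4 ≃+* F, φ GF4.w = z := by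
  have := charP_two_of_card hF
  have hz2 := primitive_cube_root hz
  let f : ZMod 2 →+* F := ZMod.castHom (dvd_refl 2) F
  have hu : z * z = f 1 + f 1 * z := by
    rw [map_one]
    linear_combination hz2 - (1 + z) * CharTwo.two_eq_zero (R := F)
  let g : GF4 →+* F := quadHom f z hu
  have hg : g GF4.w = z := by
    simp [g, quadHom_apply, GF4.w]
  have hinj : Function.Injective g := by
    rw [injective_iff_map_eq_zero]
    intro a ha
    by_contra h0
    have h1 : ∀ a : GF4, a ≠ 0 → ∃ b, a * b = 1 := by decide
    obtain ⟨b, hb⟩ := h1 a h0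
    have := congrArg g hb
    rw [map_mul, ha, zero_mul, map_one] at this
    exact zero_ne_one this
  have hbij : Function.Bijective g := by
    have : Finite F := Nat.finite_of_card_ne_zero (by omega)
    refine (Nat.bijective_iff_injective_and_card g).2 ⟨hinj, ?_⟩
    rw [hF, Nat.card_eq_fintype_card]
    decide
  exact ⟨RingEquiv.ofBijective g hbij, hg⟩

end Field

/-! ### Additive codes from Hermitian self-orthogonal codes -/

section Hermitian

variable {F : Type*} [Field F]

/-- The Hermitian form of two vectors over a field with four elements. -/
def herm {R ι : Type*} [CommRing R] [Fintype ι] (v u : ι → R) : R := ∑ i, v i * u i ^ 2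

theorem mem_hermDual {ι : Type*} [Fintype ι] {C : Submodule F (ι → F)} {v : ι → F} :
    v ∈ hermDual 2 C ↔ ∀ u ∈ C, herm v u = 0 := Iff.rfl

variable {n : ℕ}

/-- The Pauli label of a vector over a field with four elements: `a + b ω` has the label
`(a, b)`. -/
def toLabel (φ : GF4 ≃+* F) : (Fin n → F) ≃+ PauliLabel n where
  toFun v := (fun i => (φ.symm (v i)).re, fun i => (φ.symm (v i)).im)
  invFun s := fun i => φ ⟨s.1 i, s.2 i⟩
  left_inv v := by simp
  right_inv s := by simp
  map_add' v u := by
    ext i <;> simp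

/-- The symplectic form is the coefficient of `ω` in the Hermitian form. -/
theorem symp_toLabel (φ : GF4 ≃+* F) (v u : Fin n → F) :
    symp (toLabel φ v) (toLabel φ u) = (φ.symm (herm v u)).im := by
  have h : ∀ a b : GF4, (a * b ^ 2).im = a.im * b.re + b.im * a.re := by decide
  have hsum : ∀ (f : Fin n → GF4), (∑ i, f i).im = ∑ i, (f i).im := fun f =>
    map_sum (QuadraticAlgebra.imₗ (1 : ZMod 2) 1) f Finset.univ
  simp only [herm, map_sum, map_mul, map_pow, hsum, h, Finset.sum_add_distrib]
  rfl

theorem labelWeight_toLabel [DecidableEq F] (φ : GF4 ≃+* F) (v : Fin n → F) :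
    labelWeight (toLabel φ v) = hammingNorm v := by
  have h : ∀ a : GF4, (a.re ≠ 0 ∨ a.im ≠ 0) ↔ a ≠ 0 := by decide
  simp only [labelWeight, pauliWeight, hammingNorm]
  congr 1
  ext i
  simp only [Finset.mem_filter, Finset.mem_univ, true_and]
  refine (h (φ.symm (v i))).trans ?_
  simp

/-- The binary image of a Hermitian self-orthogonal code is isotropic, and its symplectic complement
is the image of the Hermitian dual. -/
theorem exists_isAdditiveCode [DecidableEq F] (φ : GF4 ≃+* F) {k d : ℕ}
    {S : Submodule F (Fin n → F)}
    (hself : S ≤ hermDual 2 S) (hrank : 2 * Module.finrank F S + k = n)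
    (hd : IsLeast {w | ∃ v ∈ hermDual 2 S, v ∉ S ∧ hammingNorm v = w} d) :
    ∃ S', IsAdditiveCode n k d S' := by
  let S' : Submodule (ZMod 2) (PauliLabel n) :=
    AddSubgroup.toZModSubmodule 2 (S.toAddSubgroup.map (toLabel φ).toAddMonoidHom)
  have hmem : ∀ v, toLabel φ v ∈ S' ↔ v ∈ S := by
    intro v
    constructor
    · rintro ⟨u, hu, h⟩
      rwa [← (toLabel φ).injective h]
    · exact fun h => ⟨v, h, rfl⟩
  have horth : ∀ v, (∀ s ∈ S', symp s (toLabel φ v) = 0) ↔ v ∈ hermDual 2 S := by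
    intro v
    rw [mem_hermDual]
    constructor
    · intro h u hu
      -- testing against `u` and against a multiple of `u` recovers both coordinates
      have h1 : ∀ c : F, (φ.symm (c ^ 2 * herm v u)).im = 0 := by
        intro c
        have := h (toLabel φ (c • u)) ((hmem _).2 (S.smul_mem c hu))
        rw [symp_comm, symp_toLabel] at this
        convert this using 4
        simp only [herm, Finset.mul_sum, Pi.smul_apply, smul_eq_mul]
        exact Finset.sum_congr rfl fun i _ => by ring
      have h2 := h1 1
      have h3 := h1 (φ (1 + GF4.w))
      rw [one_pow, one_mul] at h2
      rw [map_mul, map_pow, RingEquiv.symm_apply_apply] at h3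
      have h4 : ∀ a : GF4, a.im = 0 → ((1 + GF4.w) ^ 2 * a).im = 0 → a = 0 := by decide
      exact (map_eq_zero_iff φ.symm φ.symm.injective).1 (h4 _ h2 h3)
    · rintro h _ ⟨u, hu, rfl⟩
      change symp (toLabel φ u) _ = 0
      rw [symp_comm, symp_toLabel, h u hu, map_zero]
      rfl
  refine ⟨S', ?_, ?_, ?_⟩
  · rintro _ ⟨u, hu, rfl⟩ s hs
    rw [symp_comm]
    exact (horth u).2 (hself hu) s hs
  · have hF : Nat.card F = 4 := by
      rw [← Nat.card_congr φ.toEquiv, Nat.card_eq_fintype_card]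
      decide
    have : Finite F := Nat.finite_of_card_ne_zero (by omega)
    have h1 : Nat.card S = 4 ^ Module.finrank F S := by
      rw [Module.natCard_eq_pow_finrank (K := F), hF]
    have h2 : Nat.card S' = 2 ^ Module.finrank (ZMod 2) S' := by
      rw [Module.natCard_eq_pow_finrank (K := ZMod 2), Nat.card_zmod]
    have h3 : Nat.card S = Nat.card S' :=
      Nat.card_congr ((toLabel φ).toEquiv.subtypeEquiv fun v => (hmem v).symm)
    rw [h1, h2, show 4 = 2 ^ 2 by norm_num, ← pow_mul] at h3
    have := Nat.pow_right_injective le_rfl h3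
    omega
  · convert hd using 1
    ext w
    constructor
    · rintro ⟨e, he, heS, rfl⟩
      obtain ⟨v, rfl⟩ := (toLabel φ).surjective e
      exact ⟨v, (horth v).1 he, fun h => heS ((hmem v).2 h), (labelWeight_toLabel φ v).symm⟩
    · rintro ⟨v, hv, hvS, rfl⟩
      exact ⟨toLabel φ v, (horth v).2 hv, fun h => hvS ((hmem v).1 h), labelWeight_toLabel φ v⟩

end Hermitian

/-! ### Syndromes encoded as bit masks -/

/-- Bit `j` of a natural number, as an element of `ZMod 2`. -/
def bitAt (N j : ℕ) : ZMod 2 := if N.testBit j then 1 else 0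

theorem bitAt_xor (N M j : ℕ) : bitAt (N ^^^ M) j = bitAt N j + bitAt M j := by
  simp only [bitAt, Nat.testBit_xor]
  cases N.testBit j <;> cases M.testBit j <;> decide

/-- The vector of eleven elements of `GF4` encoded by a natural number below `2 ^ 22`: the lower
eleven bits are the constant coefficients, the upper ones the coefficients of `ω`. -/
def decode (N : ℕ) : Fin 11 → GF4 := fun j => ⟨bitAt N j, bitAt N (j + 11)⟩

theorem decode_zero : decode 0 = 0 := by
  ext j <;> simp [decode, bitAt]

theorem decode_xor (N M : ℕ) : decode (Nat.xor N M) = decode N + decode M := by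
  ext j
  · exact bitAt_xor N M j
  · exact bitAt_xor N M (j + 11)

/-- The set of all `m < 2 ^ k` with at least `t` binary digits `1`, as a bit mask. -/
def thresholdMask : ℕ → ℕ → ℕ
  | 0, 0 => 1
  | 0, _ + 1 => 0
  | k + 1, 0 => thresholdMask k 0 ||| thresholdMask k 0 <<< 2 ^ k
  | k + 1, t + 1 => thresholdMask k (t + 1) ||| thresholdMask k t <<< 2 ^ k

/-- Whether the vector encoded by `s` has weight at least `b + 3`, read off from a table.

This function and `search` are written with the functions on natural numbers and the recursors
themselves, which the kernel evaluates without unfolding instances. -/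
def heavy (b s : ℕ) : Bool :=
  Nat.beq (Nat.land 1 (Nat.shiftRight (thresholdMask 11 (b + 3))
    (Nat.land (Nat.lor s (Nat.shiftRight s 11)) 2047))) 1

/-- Whether for each sum `t` of `s` and nonzero multiples of `r ≤ b` columns from `L`, with
`1 ≤ r`, the vector encoded by `t` has weight at least `b + 3 - r`. A column is given by its code
and the code of its multiple by `ω`. -/
def search (L : List (ℕ × ℕ)) : ℕ → ℕ → Bool :=
  L.rec (fun _ _ => true) fun c _ ih b s => b.rec true fun b _ =>
    (ih (b + 1) s).and
      (((heavy b (Nat.xor s c.1)).and (ih b (Nat.xor s c.1))).and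
      (((heavy b (Nat.xor s c.2)).and (ih b (Nat.xor s c.2))).and
      ((heavy b (Nat.xor s (Nat.xor c.1 c.2))).and (ih b (Nat.xor s (Nat.xor c.1 c.2))))))

/-- The columns at the positions from `10` to `29` of the squared generator matrix `genRow`, each
given by its code and the code of its multiple by `ω`. -/
def checkColumn : Fin 20 → ℕ × ℕ :=
  ![(111765, 2431030), (224816, 3336301), (443988, 3432664), (969456, 1657305),
    (1600352, 224013), (4019654, 1271722), (1346430, 1014417), (2294742, 4043872),
    (2233136, 3904578), (3070461, 2176475), (2792037, 3781971), (2084695, 2454521),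
    (792466, 3178882), (659362, 3610945), (3638491, 1138416), (3138587, 998908),
    (847617, 3465629), (1743962, 3689299), (3434135, 56972), (1938739, 3410866)]

theorem search_checkColumn : search (List.ofFn checkColumn) 4 0 = true := by
  decide +kernel

theorem hammingNorm_succ {n : ℕ} (e : Fin (n + 1) → GF4) :
    hammingNorm e = (if e 0 ≠ 0 then 1 else 0) + hammingNorm fun i : Fin n => e i.succ := by
  rw [hammingNorm, Fin.card_filter_univ_succ']
  rfl

theorem heavy_eq (b s : ℕ) :
    heavy b s = (thresholdMask 11 (b + 3)).testBit ((s ||| s >>> 11) &&& 2047) := by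
  rw [heavy, Nat.testBit]
  change Nat.beq (1 &&& (thresholdMask 11 (b + 3) >>> ((s ||| s >>> 11) &&& 2047))) 1 = _
  rw [Nat.one_and_eq_mod_two, Bool.eq_iff_iff, Nat.beq_eq, bne_iff_ne]
  omega

/-- The number of binary digits `1` among the lowest `k` ones. -/
def digitCount (m : ℕ) : ℕ → ℕ
  | 0 => 0
  | k + 1 => (if m.testBit k then 1 else 0) + digitCount m k

theorem thresholdMask_lt (k t : ℕ) : thresholdMask k t < 2 ^ 2 ^ k := by
  have hstep : ∀ k A B : ℕ, A < 2 ^ 2 ^ k → B < 2 ^ 2 ^ k →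
      A ||| B <<< 2 ^ k < 2 ^ 2 ^ (k + 1) := by
    intro k A B hA hB
    refine Nat.or_lt_two_pow (hA.trans_le (Nat.pow_le_pow_right (by norm_num)
      (Nat.pow_le_pow_right (by norm_num) k.le_succ))) ?_
    rw [Nat.shiftLeft_eq, pow_succ 2 k, mul_two, pow_add]
    exact Nat.mul_lt_mul_of_pos_right hB (by positivity)
  induction k generalizing t with
  | zero => cases t <;> simp [thresholdMask]
  | succ k ih => cases t <;> exact hstep k _ _ (ih _) (ih _)

theorem digitCount_congr {m m' k : ℕ} (h : ∀ j < k, m.testBit j = m'.testBit j) :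
    digitCount m k = digitCount m' k := by
  induction k with
  | zero => rfl
  | succ k ih =>
    rw [digitCount, digitCount, h k k.lt_succ_self, ih fun j hj => h j (hj.trans k.lt_succ_self)]

theorem le_digitCount {k t m : ℕ} (hm : m < 2 ^ k) (h : (thresholdMask k t).testBit m) :
    t ≤ digitCount m k := by
  induction k generalizing t m with
  | zero =>
    cases t with
    | zero => exact Nat.zero_le _
    | succ t => simp [thresholdMask] at h
  | succ k ih =>
    cases t with
    | zero => exact Nat.zero_le _
    | succ t =>
      rw [thresholdMask, Nat.testBit_or, Nat.testBit_shiftLeft, Bool.or_eq_true] at h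
      rw [digitCount]
      rcases lt_or_ge m (2 ^ k) with hlt | hge
      · have h1 : (thresholdMask k (t + 1)).testBit m := by
          refine h.resolve_right fun h' => ?_
          simp only [Bool.and_eq_true, decide_eq_true_eq] at h'
          omega
        exact le_add_left (ih hlt h1)
      · have h1 : (thresholdMask k t).testBit (m - 2 ^ k) := by
          have := h.resolve_left fun h' => by
            rw [Nat.testBit_lt_two_pow ((thresholdMask_lt k _).trans_le
              (Nat.pow_le_pow_right (by norm_num) hge))] at h'
            exact absurd h' (by simp)
          simp only [Bool.and_eq_true] at this
          exact this.2
        have hlt : m - 2 ^ k < 2 ^ k := by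
          rw [pow_succ] at hm
          omega
        obtain ⟨m', rfl⟩ := Nat.exists_eq_add_of_le hge
        rw [Nat.add_sub_cancel_left] at h1 hlt
        have h2 := ih hlt h1
        have h3 : (2 ^ k + m').testBit k = true := by
          rw [Nat.testBit_two_pow_add_eq, Nat.testBit_lt_two_pow hlt]
          rfl
        rw [h3, digitCount_congr (m' := m') fun j hj => Nat.testBit_two_pow_add_gt hj m']
        simp only [if_true]
        omega

theorem digitCount_eq_card (m k : ℕ) :
    digitCount m k = (Finset.univ.filter fun j : Fin k => m.testBit j = true).card := by
  induction k with
  | zero => rfl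
  | succ k ih =>
    rw [digitCount, ih, Finset.card_filter, Finset.card_filter, Fin.sum_univ_castSucc, add_comm]
    rfl

theorem le_hammingNorm_of_heavy {b s : ℕ} (h : heavy b s = true) :
    b + 3 ≤ hammingNorm (decode s) := by
  rw [heavy_eq] at h
  have hlt : (s ||| s >>> 11) &&& 2047 < 2 ^ 11 := Nat.and_lt_two_pow _ (by norm_num)
  refine (le_digitCount hlt h).trans ?_
  rw [digitCount_eq_card]
  refine Finset.card_le_card fun j hj => ?_
  simp only [Finset.mem_filter, Finset.mem_univ, true_and, Nat.testBit_and, Nat.testBit_or,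
    Nat.testBit_shiftRight, Bool.and_eq_true, Bool.or_eq_true] at hj ⊢
  intro h0
  have h1 := congrArg QuadraticAlgebra.re h0
  have h2 := congrArg QuadraticAlgebra.im h0
  simp only [decode, bitAt, QuadraticAlgebra.re_zero, QuadraticAlgebra.im_zero, add_comm (j : ℕ) 11,
    ite_eq_right_iff, one_ne_zero, imp_false] at h1 h2
  exact hj.1.elim h1 h2

theorem search_cons (c : ℕ × ℕ) (L : List (ℕ × ℕ)) (b s : ℕ) :
    search (c :: L) (b + 1) s = (search L (b + 1) s && (heavy b (Nat.xor s c.1) &&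
      search L b (Nat.xor s c.1) && (heavy b (Nat.xor s c.2) && search L b (Nat.xor s c.2) &&
      (heavy b (Nat.xor s (Nat.xor c.1 c.2)) && search L b (Nat.xor s (Nat.xor c.1 c.2)))))) := rfl

/-- Soundness of the search, by induction on the list of columns: the head of `e` is zero or one of
the three nonzero elements of `GF4`, one for each branch of the search. -/
theorem le_hammingNorm_of_search {n : ℕ} (c : Fin n → ℕ × ℕ)
    (hc : ∀ i, decode (c i).2 = GF4.w • decode (c i).1) {b s : ℕ}
    (h : search (List.ofFn c) b s = true) (e : Fin n → GF4) (he : e ≠ 0) (heb : hammingNorm e ≤ b) :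
    b + 3 ≤ hammingNorm e + hammingNorm (decode s + ∑ i, e i • decode (c i).1) := by
  induction n generalizing b s with
  | zero => exact absurd (Subsingleton.elim e 0) he
  | succ n ih =>
    have hpos : hammingNorm e ≠ 0 := hammingNorm_ne_zero_iff.2 he
    obtain ⟨b, rfl⟩ := Nat.exists_eq_succ_of_ne_zero (show b ≠ 0 by omega)
    rw [List.ofFn_succ, Nat.succ_eq_add_one, search_cons] at h
    simp only [Bool.and_eq_true] at h
    obtain ⟨h0, ⟨h1, h1'⟩, ⟨h2, h2'⟩, h3, h3'⟩ := h
    rw [hammingNorm_succ] at heb ⊢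
    rw [Fin.sum_univ_succ]
    -- the head of `e` is nonzero and the column contributes the summand encoded by `m`
    have step : ∀ m, heavy b (Nat.xor s m) = true →
        search (List.ofFn fun i => c i.succ) b (Nat.xor s m) = true →
        e 0 • decode (c 0).1 = decode m → e 0 ≠ 0 →
        b.succ + 3 ≤ (if e 0 ≠ 0 then 1 else 0) + (hammingNorm fun i : Fin n => e i.succ) +
          hammingNorm (decode s + (e 0 • decode (c 0).1 +
            ∑ i : Fin n, e i.succ • decode (c i.succ).1)) := by
      intro m hm hm' hdec he0
      rw [if_pos he0] at heb ⊢
      rw [hdec, ← add_assoc, ← decode_xor]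
      by_cases htail : (fun i : Fin n => e i.succ) = 0
      · have h0 : ∀ i : Fin n, e i.succ = 0 := congrFun htail
        simp only [h0, zero_smul, Finset.sum_const_zero, add_zero]
        have := le_hammingNorm_of_heavy hm
        omega
      · have := ih (fun i => c i.succ) (fun i => hc i.succ) hm' (fun i => e i.succ) htail (by omega)
        omega
    have hcases : ∀ a : GF4, a = 0 ∨ a = 1 ∨ a = GF4.w ∨ a = 1 + GF4.w := by decide
    rcases hcases (e 0) with h4 | h4 | h4 | h4
    · rw [if_neg (not_not.2 h4)] at heb ⊢
      rw [h4, zero_smul, zero_add, zero_add]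
      refine ih (fun i => c i.succ) (fun i => hc i.succ) h0 (fun i => e i.succ) ?_ (by omega)
      intro htail
      apply he
      funext i
      exact Fin.cases h4 (congrFun htail) i
    · exact step _ h1 h1' (by rw [h4, one_smul]) (by rw [h4]; decide)
    · exact step _ h2 h2' (by rw [h4, hc]) (by rw [h4]; decide)
    · refine step _ h3 h3' ?_ (by rw [h4]; decide)
      rw [h4, decode_xor, hc, add_smul, one_smul]

theorem decode_checkColumn (i : Fin 20) :
    decode (checkColumn i).2 = GF4.w • decode (checkColumn i).1 := by
  funext j
  revert i j
  decide +kernel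

/-! ### A generator matrix -/

/-- The rows of a generator matrix, whose first ten rows span the Hermitian hull: it has the form
`(1 | A)` in these rows and `(0 | u)` in the last one. -/
def genRow (j : Fin 11) (i : Fin 30) : GF4 :=
  Fin.addCases (m := 10) (n := 20) (fun i => if (j : ℕ) = i then 1 else 0)
    (fun i => decode (checkColumn i).1 j ^ 2) i

theorem GF4.pow_four (a : GF4) : (a ^ 2) ^ 2 = a := by
  revert a
  decide

theorem sum_fin_thirty {A : Type*} [AddCommMonoid A] (f : Fin 30 → A) :
    ∑ i, f i = ∑ i : Fin 10, f (Fin.castAdd 20 i) + ∑ i : Fin 20, f (Fin.natAdd 10 i) :=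
  Fin.sum_univ_add (a := 10) (b := 20) f

theorem herm_genRow (v : Fin 30 → GF4) (j : Fin 11) :
    herm v (genRow j) = (∑ i : Fin 10, if (j : ℕ) = i then v (Fin.castAdd 20 i) else 0) +
      ∑ i : Fin 20, v (Fin.natAdd 10 i) * decode (checkColumn i).1 j := by
  rw [herm, sum_fin_thirty]
  refine congrArg₂ (· + ·) ?_ ?_
  · refine Finset.sum_congr rfl fun i _ => ?_
    have : genRow j (Fin.castAdd 20 i) = if (j : ℕ) = i then 1 else 0 :=
      Fin.addCases_left (m := 10) (n := 20) i
    rw [this]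
    split_ifs <;> simp
  · refine Finset.sum_congr rfl fun i _ => ?_
    have : genRow j (Fin.natAdd 10 i) = decode (checkColumn i).1 j ^ 2 :=
      Fin.addCases_right (m := 10) (n := 20) i
    rw [this, GF4.pow_four]

theorem hammingNorm_eq_sum {ι : Type*} [Fintype ι] (v : ι → GF4) :
    hammingNorm v = ∑ i, if v i ≠ 0 then 1 else 0 := by
  rw [hammingNorm, Finset.card_filter]

/-- A vector orthogonal to the hull is determined by its last twenty entries `e`: the vector
`∑ e i • c i` lists its first ten entries and its product with the last row. -/
theorem seven_le_of_tail_le {v : Fin 30 → GF4} (hv : ∀ j : Fin 10, herm v (genRow j.castSucc) = 0)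
    (hv0 : v ≠ 0) (htail : (hammingNorm fun i : Fin 20 => v (Fin.natAdd 10 i)) ≤ 4) :
    7 ≤ hammingNorm v + if herm v (genRow (Fin.last 10)) ≠ 0 then 1 else 0 := by
  set e : Fin 20 → GF4 := fun i => v (Fin.natAdd 10 i) with he
  set y : Fin 11 → GF4 := ∑ i, e i • decode (checkColumn i).1 with hy
  have hyj : ∀ j, y j = ∑ i : Fin 20, v (Fin.natAdd 10 i) * decode (checkColumn i).1 j := by
    intro j
    rw [hy, Finset.sum_apply]
    rfl
  have hhead : ∀ j : Fin 10, y j.castSucc = v (Fin.castAdd 20 j) := by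
    intro j
    have h := hv j
    rw [herm_genRow, ← hyj, CharTwo.add_eq_zero] at h
    rw [← h, Finset.sum_eq_single j]
    · simp
    · intro i _ hij
      rw [if_neg]
      intro h
      exact hij (Fin.ext h.symm)
    · simp
  have hlast : y (Fin.last 10) = herm v (genRow (Fin.last 10)) := by
    rw [herm_genRow, ← hyj, Finset.sum_eq_zero, zero_add]
    intro i _
    rw [if_neg]
    have := i.2
    simp only [Fin.val_last]
    omega
  have he0 : e ≠ 0 := by
    intro h0
    have hy0 : y = 0 := by
      rw [hy]
      exact Finset.sum_eq_zero fun i _ => by rw [h0, Pi.zero_apply, zero_smul]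
    apply hv0
    funext i
    refine Fin.addCases (m := 10) (n := 20) (fun i => ?_) (fun i => ?_) i
    · exact (hhead i).symm.trans (congrFun hy0 _)
    · exact congrFun h0 i
  have h := le_hammingNorm_of_search checkColumn decode_checkColumn search_checkColumn e he0 htail
  rw [decode_zero, zero_add, ← hy] at h
  refine h.trans (le_of_eq ?_)
  rw [hammingNorm_eq_sum v, sum_fin_thirty, hammingNorm_eq_sum y, Fin.sum_univ_castSucc,
    hammingNorm_eq_sum e, hlast]
  simp only [hhead, he]
  ring

/-! ### Explicit words of the code -/

/-- The elements of `GF4`, numbered as `0, 1, ω, ω ^ 2`. -/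
def sym : Fin 4 → GF4 := ![0, 1, GF4.w, GF4.w ^ 2]

/-- The cyclic shift of a word by one row of two positions. -/
def rowShift {A : Type*} (v : Fin 30 → A) : Fin 30 → A := fun i => v (i - 2)

/-- The coefficients of the polynomials `f10` and `f11`, interleaved. -/
def firstWord (i : Fin 30) : GF4 :=
  sym ((![0, 1, 0, 2, 0, 0, 2, 3, 0, 2, 1, 3, 3, 1, 0,
    3, 0, 0, 3, 1, 1, 3, 0, 0, 2, 3, 0, 3, 0, 0] : Fin 30 → Fin 4) i)

/-- The coefficients of the polynomials `f20` and `f21`, interleaved. -/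
def secondWord (i : Fin 30) : GF4 :=
  sym ((![0, 0, 0, 1, 0, 1, 0, 3, 0, 1, 0, 0, 0, 2, 0,
    2, 0, 1, 0, 2, 0, 0, 0, 3, 0, 3, 0, 2, 0, 3] : Fin 30 → Fin 4) i)

/-- The coefficients that express the rows of the generator matrix by the first nine shifts of the
first word and the first two shifts of the second one. -/
def shiftCoeff (j k : Fin 11) : GF4 :=
  sym ((
    ![![2, 3, 0, 1, 3, 1, 3, 3, 2, 0, 0],
    ![1, 0, 1, 2, 3, 0, 1, 0, 0, 2, 1],
    ![1, 3, 1, 3, 0, 3, 3, 3, 3, 2, 1],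
    ![0, 2, 2, 3, 0, 2, 1, 2, 2, 0, 3],
    ![0, 3, 2, 3, 0, 0, 2, 3, 3, 3, 1],
    ![3, 0, 1, 1, 0, 2, 0, 0, 1, 2, 2],
    ![3, 0, 0, 0, 3, 3, 1, 0, 2, 0, 2],
    ![3, 2, 0, 2, 3, 3, 0, 2, 1, 2, 1],
    ![2, 1, 3, 0, 1, 2, 3, 2, 2, 1, 1],
    ![1, 3, 3, 3, 2, 2, 1, 3, 0, 2, 2],
    ![1, 3, 3, 3, 3, 3, 3, 3, 3, 0, 3]] :
    Fin 11 → Fin 11 → Fin 4) j k)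

/-- The coefficients of a word with respect to the rows of the generator matrix, provided that it
is in their span; they can be read off from its first eleven entries. -/
def rowCoeff (v : Fin 30 → GF4) : Fin 11 → GF4 :=
  Fin.snoc (fun j : Fin 10 => v (Fin.castLE (by norm_num) j))
    (v 10 + ∑ j : Fin 10, v (Fin.castLE (by norm_num) j) * genRow j.castSucc 10)

/-- A word of weight six that is orthogonal to the hull, but not to the code. -/
def wordSix (i : Fin 30) : GF4 :=
  sym ((![0, 3, 0, 0, 1, 0, 0, 3, 3, 1, 0, 0, 0, 0, 0,
    0, 0, 0, 0, 0, 0, 0, 1, 0, 0, 0, 0, 0, 0, 0] : Fin 30 → Fin 4) i)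

/-- A word of weight seven that is orthogonal to the code. -/
def wordSeven (i : Fin 30) : GF4 :=
  sym ((![0, 1, 1, 2, 0, 0, 0, 0, 1, 2, 0, 1, 0, 0, 0,
    0, 0, 0, 0, 0, 3, 0, 0, 0, 0, 0, 0, 0, 0, 0] : Fin 30 → Fin 4) i)

theorem genRow_eq_sum_shifts : ∀ j i, genRow j i =
    (∑ k : Fin 9, shiftCoeff j (Fin.castAdd 2 k) * (rowShift^[k] firstWord) i) +
      ∑ k : Fin 2, shiftCoeff j (Fin.natAdd 9 k) * (rowShift^[k] secondWord) i := by
  decide +kernel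

theorem firstWord_eq_sum_genRow :
    ∀ i, firstWord i = ∑ k, rowCoeff firstWord k * genRow k i := by
  decide +kernel

theorem secondWord_eq_sum_genRow :
    ∀ i, secondWord i = ∑ k, rowCoeff secondWord k * genRow k i := by
  decide +kernel

theorem rowShift_genRow_eq_sum_genRow :
    ∀ j i, rowShift (genRow j) i = ∑ k, rowCoeff (rowShift (genRow j)) k * genRow k i := by
  decide +kernel

theorem herm_genRow_genRow : ∀ (j : Fin 10) (k : Fin 11),
    herm (genRow j.castSucc) (genRow k) = 0 := by
  decide +kernel

theorem herm_lastRow_self : herm (genRow (Fin.last 10)) (genRow (Fin.last 10)) = 1 := by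
  decide +kernel

theorem hammingNorm_wordSix : hammingNorm wordSix = 6 := by
  decide +kernel

theorem hammingNorm_wordSeven : hammingNorm wordSeven = 7 := by
  decide +kernel

theorem herm_wordSix_genRow : ∀ j : Fin 10, herm wordSix (genRow j.castSucc) = 0 := by
  decide +kernel

theorem herm_wordSeven_genRow : ∀ j : Fin 11, herm wordSeven (genRow j) = 0 := by
  decide +kernel

theorem herm_wordSix_wordSeven : herm wordSix wordSeven ≠ 0 := by
  decide +kernel

/-! ### Values of the generators -/

/-- The value at `a` of the polynomial with coefficients in one column of a word. -/
def columnValue {A : Type*} [CommRing A] (f : GF4 →+* A) (v : Fin 30 → GF4) (t : Fin 2) (a : A) :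
    A :=
  ∑ g : Fin 15, f (v (finProdFinEquiv (g, t))) * a ^ (g : ℕ)

/-- The generator `ξ` of `GF16`. -/
def GF16.xi : GF16 := ⟨0, 1⟩

theorem firstWord_values_small :
    (∀ t, columnValue (RingHom.id GF4) firstWord t 1 = ![0, 1] t) ∧
    (∀ t, columnValue (RingHom.id GF4) firstWord t GF4.w = ![1, GF4.w] t) ∧
    (∀ t, columnValue (RingHom.id GF4) firstWord t (GF4.w ^ 2) = ![1, GF4.w] t) := by
  decide +kernel

theorem secondWord_values_small :
    (∀ t, columnValue (RingHom.id GF4) secondWord t 1 = 0) ∧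
    (∀ t, columnValue (RingHom.id GF4) secondWord t GF4.w = 0) ∧
    (∀ t, columnValue (RingHom.id GF4) secondWord t (GF4.w ^ 2) = 0) := by
  decide +kernel

theorem xi_pow_values : ∀ t,
    (columnValue (algebraMap GF4 GF16) firstWord t (GF16.xi ^ 6) = 0 ∧
      columnValue (algebraMap GF4 GF16) secondWord t (GF16.xi ^ 6) = 0) ∧
    (columnValue (algebraMap GF4 GF16) firstWord t (GF16.xi ^ 3) = ![1, GF16.xi ^ 10] t ∧
      columnValue (algebraMap GF4 GF16) secondWord t (GF16.xi ^ 3) = 0) ∧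
    (columnValue (algebraMap GF4 GF16) firstWord t GF16.xi = ![1, 1] t ∧
      columnValue (algebraMap GF4 GF16) secondWord t GF16.xi = 0) ∧
    (columnValue (algebraMap GF4 GF16) firstWord t (GF16.xi ^ 11) = ![1, 0] t ∧
      columnValue (algebraMap GF4 GF16) secondWord t (GF16.xi ^ 11) = ![0, 1] t) ∧
    (columnValue (algebraMap GF4 GF16) firstWord t (GF16.xi ^ 2) = 0 ∧
      columnValue (algebraMap GF4 GF16) secondWord t (GF16.xi ^ 2) = 0) ∧
    (columnValue (algebraMap GF4 GF16) firstWord t (GF16.xi ^ 7) = 0 ∧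
      columnValue (algebraMap GF4 GF16) secondWord t (GF16.xi ^ 7) = 0) := by
  decide +kernel

/-! ### Quasi-cyclic codes and their constituents -/

section QuasiCyclic

variable {F : Type*} [Field F] {A : Type*} [CommRing A] [Algebra F A]

/-- The cyclic shift by two positions, as a linear map. -/
def shiftMap (F : Type*) [Field F] : (Fin (15 * 2) → F) →ₗ[F] (Fin (15 * 2) → F) :=
  LinearMap.funLeft F F ((finRotate (15 * 2) ^ 2).symm)

theorem shiftInvariant_iff {D : Submodule F (Fin (15 * 2) → F)} :
    ShiftInvariant 2 D ↔ ∀ c ∈ D, shiftMap F c ∈ D := Iff.rfl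

theorem shiftMap_eq_rowShift (c : Fin (15 * 2) → F) : shiftMap F c = rowShift c := by
  have h : ∀ i : Fin 30, (finRotate (15 * 2) ^ 2).symm i = i - 2 := by decide +kernel
  funext i
  exact congrArg c (h i)

theorem entry_shiftMap (c : Fin (15 * 2) → F) (g : Fin 15) (t : Fin 2) :
    entry (shiftMap F c) (g + 1) t = entry c g t := by
  have h : ∀ (g : Fin 15) (t : Fin 2), (finRotate (15 * 2) ^ 2).symm (finProdFinEquiv (g + 1, t)) =
      finProdFinEquiv (g, t) := by decide +kernel
  exact congrArg c (h g t)

theorem evalAt_apply (a : A) (c : Fin (15 * 2) → F) (t : Fin 2) :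
    evalAt 15 2 a c t = ∑ g : Fin 15, entry c g t • a ^ (g : ℕ) := rfl

theorem evalAt_shiftMap {a : A} (ha : a ^ 15 = 1) (c : Fin (15 * 2) → F) :
    evalAt 15 2 a (shiftMap F c) = a • evalAt 15 2 a c := by
  funext t
  rw [Pi.smul_apply, evalAt_apply, evalAt_apply, ← Equiv.sum_comp (Equiv.addRight (1 : Fin 15)),
    Finset.smul_sum]
  refine Finset.sum_congr rfl fun g _ => ?_
  rw [Equiv.coe_addRight, entry_shiftMap, Fin.val_add, ← pow_eq_pow_mod _ ha, pow_add, smul_comm,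
    smul_eq_mul, mul_comm (a ^ (g : ℕ))]
  simp

theorem evalAt_aeval_shiftMap {a : A} (ha : a ^ 15 = 1) (p : F[X]) (c : Fin (15 * 2) → F) :
    evalAt 15 2 a (aeval (shiftMap F) p c) = aeval a p • evalAt 15 2 a c := by
  induction p using Polynomial.induction_on' with
  | add p q hp hq => rw [map_add, map_add, LinearMap.add_apply, map_add, hp, hq, add_smul]
  | monomial n r =>
    rw [aeval_monomial, aeval_monomial, Module.End.mul_apply, Module.algebraMap_end_apply, map_smul,
      mul_smul, algebraMap_smul]
    congr 1
    induction n with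
    | zero => simp
    | succ n ih =>
      rw [pow_succ', Module.End.mul_apply, evalAt_shiftMap ha, ih, smul_smul, pow_succ']

theorem aeval_shiftMap_mem {D : Submodule F (Fin (15 * 2) → F)} (hD : ShiftInvariant 2 D) (p : F[X])
    {c : Fin (15 * 2) → F} (hc : c ∈ D) : aeval (shiftMap F) p c ∈ D := by
  induction p using Polynomial.induction_on' with
  | add p q hp hq =>
    rw [map_add]
    exact D.add_mem hp hq
  | monomial n r =>
    rw [aeval_monomial, Module.End.mul_apply, Module.algebraMap_end_apply]
    refine D.smul_mem _ ?_
    induction n with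
    | zero => exact hc
    | succ n ih =>
      rw [pow_succ', Module.End.mul_apply]
      exact shiftInvariant_iff.1 hD _ ih

theorem pow_shiftMap_mem {D : Submodule F (Fin (15 * 2) → F)} (hD : ShiftInvariant 2 D) (k : ℕ)
    {c : Fin (15 * 2) → F} (hc : c ∈ D) : (shiftMap F ^ k) c ∈ D := by
  have := aeval_shiftMap_mem hD (X ^ k) hc
  rwa [map_pow, aeval_X] at this

/-- The polynomial `c_t(x)` of a word. -/
noncomputable def columnPoly (c : Fin (15 * 2) → F) (t : Fin 2) : F[X] :=
  ∑ g : Fin 15, monomial (g : ℕ) (entry c g t)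

theorem aeval_columnPoly (a : A) (c : Fin (15 * 2) → F) (t : Fin 2) :
    aeval a (columnPoly c t) = evalAt 15 2 a c t := by
  rw [columnPoly, map_sum, evalAt_apply]
  exact Finset.sum_congr rfl fun g _ => by rw [aeval_monomial, Algebra.smul_def]

theorem polyRep_apply (c : Fin (15 * 2) → F) (t : Fin 2) :
    polyRep 15 2 c t = toR (columnPoly c t) := by
  rw [polyRep, ← aeval_columnPoly, AdjoinRoot.aeval_eq]
  rfl

theorem root_pow_fifteen : AdjoinRoot.root (X ^ 15 - 1 : F[X]) ^ 15 = 1 := by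
  have h := AdjoinRoot.mk_self (f := (X ^ 15 - 1 : F[X]))
  rw [map_sub, map_pow, AdjoinRoot.mk_X, map_one, sub_eq_zero] at h
  exact h

theorem polyRep_aeval_shiftMap (p : F[X]) (c : Fin (15 * 2) → F) :
    polyRep 15 2 (aeval (shiftMap F) p c) = toR p • polyRep 15 2 c := by
  rw [polyRep, evalAt_aeval_shiftMap root_pow_fifteen, AdjoinRoot.aeval_eq]
  rfl

theorem polyRep_injective : Function.Injective (polyRep (F := F) 15 2) := by
  rw [injective_iff_map_eq_zero]
  intro c hc
  have hcoef : ∀ g t, entry c g t = 0 := by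
    intro g t
    have h1 := congrFun hc t
    rw [polyRep_apply, toR, Pi.zero_apply, AdjoinRoot.mk_eq_zero] at h1
    have h2 : columnPoly c t = 0 := by
      refine eq_zero_of_dvd_of_degree_lt h1 ?_
      have hdeg : (X ^ 15 - 1 : F[X]).degree = 15 := by
        have := degree_X_pow_sub_C (n := 15) (by norm_num) (1 : F)
        rwa [map_one] at this
      rw [hdeg]
      refine (degree_sum_le _ _).trans_lt
        ((Finset.sup_lt_iff (by exact WithBot.bot_lt_coe 15)).2 ?_)
      intro g _
      refine (degree_monomial_le _ _).trans_lt ?_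
      exact_mod_cast g.2
    have h3 := congrArg (fun p => p.coeff (g : ℕ)) h2
    simp only [columnPoly, finsetSum_coeff, coeff_monomial, coeff_zero] at h3
    rwa [Finset.sum_eq_single g (fun g' _ hg => if_neg fun h => hg (Fin.ext h)) (by simp),
      if_pos rfl] at h3
  funext i
  obtain ⟨⟨g, t⟩, rfl⟩ := finProdFinEquiv.surjective i
  exact hcoef g t

/-- If the word vanishes at a root of the irreducible factor `f`, then the cofactor of `f` kills
the word. -/
theorem aeval_cofactor_eq_zero [Nontrivial A] {a : A} {f g : F[X]} (hfg : f * g = X ^ 15 - 1)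
    (hf : Irreducible f) (ha : aeval a f = 0) {c : Fin (15 * 2) → F} (hc : evalAt 15 2 a c = 0) :
    aeval (shiftMap F) g c = 0 := by
  apply polyRep_injective
  rw [polyRep_aeval_shiftMap, map_zero]
  funext t
  rw [Pi.smul_apply, polyRep_apply, smul_eq_mul, toR, toR, ← map_mul, Pi.zero_apply,
    AdjoinRoot.mk_eq_zero, ← hfg, mul_comm g]
  refine mul_dvd_mul_right ?_ g
  by_contra hdvd
  obtain ⟨u, v, huv⟩ := (hf.coprime_iff_not_dvd).2 hdvd
  have h := congrArg (aeval a) huv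
  rw [map_add, map_mul, map_mul, ha, aeval_columnPoly, hc] at h
  simp at h

end QuasiCyclic

section Constituents

variable {F A : Type*} [Field F] [Field A] [Algebra F A]

/-- The constituent at a generator `a` of `A` consists of the values at `a` of the codewords; no
span is needed. -/
theorem exists_evalAt_eq_of_mem_constituent {D : Submodule F (Fin (15 * 2) → F)}
    (hD : ShiftInvariant 2 D) {a : A} (ha : a ^ 15 = 1) (hgen : ∀ y : A, ∃ p : F[X], aeval a p = y)
    {v : Fin 2 → A} (hv : v ∈ constituent 15 2 a D) : ∃ d ∈ D, evalAt 15 2 a d = v := by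
  induction hv using Submodule.span_induction with
  | mem v hv => exact hv
  | zero => exact ⟨0, D.zero_mem, map_zero _⟩
  | add v w _ _ hv hw =>
    obtain ⟨d, hd, rfl⟩ := hv
    obtain ⟨e, he, rfl⟩ := hw
    exact ⟨d + e, D.add_mem hd he, map_add _ _ _⟩
  | smul y v _ hv =>
    obtain ⟨d, hd, rfl⟩ := hv
    obtain ⟨p, rfl⟩ := hgen y
    exact ⟨_, aeval_shiftMap_mem hD p hd, evalAt_aeval_shiftMap ha p d⟩

/-- Modulo words that vanish at `a`, two quasi-cyclic codes with the same constituent at `a` have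
the same elements, and the cofactor of `f` kills those words. -/
theorem aeval_cofactor_mem {D D' : Submodule F (Fin (15 * 2) → F)}
    (hD' : ShiftInvariant 2 D') {a : A} (ha : a ^ 15 = 1)
    (hgen : ∀ y : A, ∃ p : F[X], aeval a p = y) {f g : F[X]} (hfg : f * g = X ^ 15 - 1)
    (hf : Irreducible f) (haf : aeval a f = 0)
    (hconst : constituent 15 2 a D = constituent 15 2 a D') {c : Fin (15 * 2) → F} (hc : c ∈ D) :
    aeval (shiftMap F) g c ∈ D' := by
  have hmem : evalAt 15 2 a c ∈ constituent 15 2 a D' := by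
    rw [← hconst]
    exact Submodule.subset_span ⟨c, hc, rfl⟩
  obtain ⟨d, hd, hdc⟩ := exists_evalAt_eq_of_mem_constituent hD' ha hgen hmem
  have h0 : aeval (shiftMap F) g (c - d) = 0 :=
    aeval_cofactor_eq_zero hfg hf haf (by rw [map_sub, hdc, sub_self])
  rw [map_sub, sub_eq_zero] at h0
  rw [h0]
  exact aeval_shiftMap_mem hD' g hd

/-- The cofactors of pairwise coprime factors generate the unit ideal. -/
theorem mem_of_aeval_cofactor_mem {D' : Submodule F (Fin (15 * 2) → F)} (hD' : ShiftInvariant 2 D')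
    {f : Fin 9 → F[X]} (hcop : Pairwise (Function.onFun IsCoprime f)) {c : Fin (15 * 2) → F}
    (hc : ∀ i, aeval (shiftMap F) (∏ j ∈ {i}ᶜ, f j) c ∈ D') : c ∈ D' := by
  obtain ⟨μ, hμ⟩ := exists_sum_eq_one_iff_pairwise_coprime'.2 hcop
  have h : aeval (shiftMap F) (∑ i, μ i * ∏ j ∈ {i}ᶜ, f j) c = c := by
    rw [hμ, map_one, Module.End.one_apply]
  rw [← h, map_sum, LinearMap.sum_apply]
  refine D'.sum_mem fun i _ => ?_
  rw [map_mul, Module.End.mul_apply]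
  exact aeval_shiftMap_mem hD' _ (hc i)

/-- The code spanned by the row shifts of two words. -/
def shiftSpan (w w' : Fin (15 * 2) → F) : Submodule F (Fin (15 * 2) → F) :=
  Submodule.span F (Set.range (fun k : ℕ => (shiftMap F ^ k) w) ∪
    Set.range (fun k : ℕ => (shiftMap F ^ k) w'))

variable (w w' : Fin (15 * 2) → F)

theorem pow_shiftMap_mem_left (k : ℕ) : (shiftMap F ^ k) w ∈ shiftSpan w w' :=
  Submodule.subset_span (Or.inl ⟨k, rfl⟩)

theorem pow_shiftMap_mem_right (k : ℕ) : (shiftMap F ^ k) w' ∈ shiftSpan w w' :=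
  Submodule.subset_span (Or.inr ⟨k, rfl⟩)

theorem shiftSpan_le {D : Submodule F (Fin (15 * 2) → F)} (hD : ShiftInvariant 2 D) (hw : w ∈ D)
    (hw' : w' ∈ D) : shiftSpan w w' ≤ D := by
  refine Submodule.span_le.2 ?_
  rintro _ (⟨k, rfl⟩ | ⟨k, rfl⟩)
  · exact pow_shiftMap_mem hD k hw
  · exact pow_shiftMap_mem hD k hw'

theorem shiftInvariant_shiftSpan : ShiftInvariant 2 (shiftSpan w w') := by
  rw [shiftInvariant_iff]
  intro c hc
  induction hc using Submodule.span_induction with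
  | mem c hc =>
    rcases hc with ⟨k, rfl⟩ | ⟨k, rfl⟩
    · have := pow_shiftMap_mem_left w w' (k + 1)
      rwa [pow_succ'] at this
    · have := pow_shiftMap_mem_right w w' (k + 1)
      rwa [pow_succ'] at this
  | zero =>
    rw [map_zero]
    exact Submodule.zero_mem _
  | add c d _ _ hc hd =>
    rw [map_add]
    exact Submodule.add_mem _ hc hd
  | smul r c _ hc =>
    rw [map_smul]
    exact Submodule.smul_mem _ _ hc

theorem evalAt_mem_span_of_mem_shiftSpan {B : Type*} [CommRing B] [Algebra F B] {b : B}
    (hb : b ^ 15 = 1) {c : Fin (15 * 2) → F} (hc : c ∈ shiftSpan w w') :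
    evalAt 15 2 b c ∈ Submodule.span B {evalAt 15 2 b w, evalAt 15 2 b w'} := by
  have hpow : ∀ (k : ℕ) (u : Fin (15 * 2) → F),
      evalAt 15 2 b ((shiftMap F ^ k) u) = b ^ k • evalAt 15 2 b u := by
    intro k u
    have := evalAt_aeval_shiftMap hb (X ^ k) u
    rwa [map_pow, aeval_X, map_pow, aeval_X] at this
  induction hc using Submodule.span_induction with
  | mem c hc =>
    rcases hc with ⟨k, rfl⟩ | ⟨k, rfl⟩ <;> simp only [hpow] <;>
      exact Submodule.smul_mem _ _ (Submodule.subset_span (by simp))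
  | zero =>
    rw [map_zero]
    exact Submodule.zero_mem _
  | add c d _ _ hc hd =>
    rw [map_add]
    exact Submodule.add_mem _ hc hd
  | smul r c _ hc =>
    rw [map_smul, ← algebraMap_smul B r]
    exact Submodule.smul_mem _ _ hc

theorem constituent_shiftSpan {a : A} (ha : a ^ 15 = 1) :
    constituent 15 2 a (shiftSpan w w') =
      Submodule.span A {evalAt 15 2 a w, evalAt 15 2 a w'} := by
  apply le_antisymm
  · refine Submodule.span_le.2 ?_
    rintro _ ⟨c, hc, rfl⟩
    exact evalAt_mem_span_of_mem_shiftSpan w w' ha hc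
  · refine Submodule.span_le.2 ?_
    rintro _ (rfl | rfl)
    · exact Submodule.subset_span ⟨w, pow_shiftMap_mem_left w w' 0, rfl⟩
    · exact Submodule.subset_span ⟨w', pow_shiftMap_mem_right w w' 0, rfl⟩

theorem map_polyRep_shiftSpan :
    (shiftSpan w w').map (polyRep 15 2) =
      (Submodule.span (cycRing F 15) {polyRep 15 2 w, polyRep 15 2 w'}).restrictScalars F := by
  apply le_antisymm
  · rintro _ ⟨c, hc, rfl⟩
    exact evalAt_mem_span_of_mem_shiftSpan w w' root_pow_fifteen hc
  · intro v hv
    obtain ⟨r, s, rfl⟩ := Submodule.mem_span_pair.1 hv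
    obtain ⟨p, rfl⟩ := AdjoinRoot.mk_surjective r
    obtain ⟨q, rfl⟩ := AdjoinRoot.mk_surjective s
    refine ⟨aeval (shiftMap F) p w + aeval (shiftMap F) q w', Submodule.add_mem _ ?_ ?_, ?_⟩
    · exact aeval_shiftMap_mem (shiftInvariant_shiftSpan w w') p (pow_shiftMap_mem_left w w' 0)
    · exact aeval_shiftMap_mem (shiftInvariant_shiftSpan w w') q (pow_shiftMap_mem_right w w' 0)
    · rw [map_add, polyRep_aeval_shiftMap, polyRep_aeval_shiftMap]
      rfl

end Constituents

/-! ### The Hermitian form over a field with four elements -/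

section Herm

variable {F : Type*} [Field F] {ι : Type*} [Fintype ι]

theorem charP_two_of_gf4_equiv (φ : GF4 ≃+* F) : CharP F 2 :=
  charP_of_injective_ringHom (f := φ.toRingHom) φ.injective 2

theorem pow_four_of_gf4_equiv (φ : GF4 ≃+* F) (a : F) : (a ^ 2) ^ 2 = a := by
  obtain ⟨b, rfl⟩ := φ.surjective a
  rw [← map_pow, ← map_pow, GF4.pow_four]

/-- The Hermitian form is linear in its first argument. -/
def hermLin (u : ι → F) : (ι → F) →ₗ[F] F where
  toFun v := herm v u
  map_add' v w := by simp [herm, add_mul, Finset.sum_add_distrib]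
  map_smul' c v := by simp [herm, Finset.mul_sum, mul_assoc]

theorem hermLin_apply (u v : ι → F) : hermLin u v = herm v u := rfl

theorem herm_add_right [CharP F 2] (v u u' : ι → F) : herm v (u + u') = herm v u + herm v u' := by
  simp only [herm, Pi.add_apply, CharTwo.add_sq, mul_add, Finset.sum_add_distrib]

theorem herm_smul_right (c : F) (v u : ι → F) : herm v (c • u) = c ^ 2 * herm v u := by
  simp only [herm, Pi.smul_apply, smul_eq_mul, Finset.mul_sum]
  exact Finset.sum_congr rfl fun i _ => by ring

theorem herm_comm (φ : GF4 ≃+* F) (v u : ι → F) : herm u v = herm v u ^ 2 := by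
  have := charP_two_of_gf4_equiv φ
  rw [herm, herm, CharTwo.sum_sq]
  exact Finset.sum_congr rfl fun i _ => by rw [mul_pow, pow_four_of_gf4_equiv φ, mul_comm]

theorem herm_eq_zero_comm (φ : GF4 ≃+* F) {v u : ι → F} (h : herm v u = 0) : herm u v = 0 := by
  rw [herm_comm φ, h, zero_pow two_ne_zero]

theorem mem_hermDual_span [CharP F 2] {κ : Type*} {b : κ → ι → F} {v : ι → F} :
    v ∈ hermDual 2 (Submodule.span F (Set.range b)) ↔ ∀ j, herm v (b j) = 0 := by
  rw [mem_hermDual]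
  refine ⟨fun h j => h _ (Submodule.subset_span ⟨j, rfl⟩), fun h u hu => ?_⟩
  induction hu using Submodule.span_induction with
  | mem u hu =>
    obtain ⟨j, rfl⟩ := hu
    exact h j
  | zero => simp [herm]
  | add u u' _ _ hu hu' => rw [herm_add_right, hu, hu', add_zero]
  | smul c u _ hu => rw [herm_smul_right, hu, mul_zero]

theorem herm_map {R S : Type*} [CommRing R] [CommRing S] (f : R →+* S) (v u : ι → R) :
    herm (fun i => f (v i)) (fun i => f (u i)) = f (herm v u) := by
  simp only [herm, map_sum, map_mul, map_pow]

end Herm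

section Shift

variable {F : Type*} [Field F]

theorem herm_shiftMap (v u : Fin (15 * 2) → F) :
    herm (shiftMap F v) (shiftMap F u) = herm v u :=
  Equiv.sum_comp ((finRotate (15 * 2) ^ 2).symm) fun i => v i * u i ^ 2

theorem shiftMap_pow_fifteen : shiftMap F ^ 15 = 1 := by
  refine LinearMap.ext fun c => polyRep_injective ?_
  have h := polyRep_aeval_shiftMap (X ^ 15) c
  rw [map_pow, aeval_X] at h
  have h1 : toR (X ^ 15 : F[X]) = 1 := by
    rw [toR, map_pow, AdjoinRoot.mk_X, root_pow_fifteen]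
  rw [h, h1, one_smul, Module.End.one_apply]

theorem shiftInvariant_hermDual {D : Submodule F (Fin (15 * 2) → F)} (hD : ShiftInvariant 2 D) :
    ShiftInvariant 2 (hermDual 2 D) := by
  rw [shiftInvariant_iff]
  intro v hv
  rw [mem_hermDual] at hv ⊢
  intro c hc
  have h : c = shiftMap F ((shiftMap F ^ 14) c) := by
    rw [← Module.End.mul_apply, ← pow_succ', shiftMap_pow_fifteen, Module.End.one_apply]
  rw [h, herm_shiftMap]
  exact hv _ (pow_shiftMap_mem hD 14 hc)

theorem shiftInvariant_inf {D D' : Submodule F (Fin (15 * 2) → F)} (hD : ShiftInvariant 2 D)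
    (hD' : ShiftInvariant 2 D') : ShiftInvariant 2 (D ⊓ D') :=
  fun c hc => ⟨hD c hc.1, hD' c hc.2⟩

theorem pow_shiftMap_mem_iff {D : Submodule F (Fin (15 * 2) → F)} (hD : ShiftInvariant 2 D) {k : ℕ}
    (hk : k ≤ 15) {c : Fin (15 * 2) → F} : (shiftMap F ^ k) c ∈ D ↔ c ∈ D := by
  refine ⟨fun h => ?_, pow_shiftMap_mem hD k⟩
  have := pow_shiftMap_mem hD (15 - k) h
  rwa [← Module.End.mul_apply, ← pow_add, Nat.sub_add_cancel hk, shiftMap_pow_fifteen] at this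

theorem pow_five_shiftMap_apply (c : Fin (15 * 2) → F) (i : Fin 30) :
    (shiftMap F ^ 5) c i = c (i - 10 : Fin 30) := by
  have h : ∀ i : Fin 30, i - 2 - 2 - 2 - 2 - 2 = i - 10 := by decide
  rw [← h]
  simp only [pow_succ, pow_zero, one_mul, Module.End.mul_apply, shiftMap_eq_rowShift]
  rfl

variable [DecidableEq F]

theorem hammingNorm_pow_shiftMap (k : ℕ) (c : Fin (15 * 2) → F) :
    hammingNorm ((shiftMap F ^ k) c) = hammingNorm c := by
  induction k with
  | zero => rfl
  | succ k ih =>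
    rw [pow_succ', Module.End.mul_apply, ← ih]
    generalize (shiftMap F ^ k) c = d
    simp only [hammingNorm, Finset.card_filter]
    exact Equiv.sum_comp ((finRotate (15 * 2) ^ 2).symm) fun i => if d i ≠ 0 then 1 else 0

/-- The last twenty positions, shifted by ten positions at a time, cover each position twice. -/
theorem sum_tail_shifts (f : Fin 30 → ℕ) :
    ∑ i : Fin 20, f (Fin.natAdd 10 i) + ∑ i : Fin 20, f ((Fin.natAdd 10 i : Fin 30) - 10) +
      ∑ i : Fin 20, f ((Fin.natAdd 10 i : Fin 30) - 10 - 10) = 2 * ∑ i, f i := by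
  have h1 : ∀ i : Fin 10, (Fin.natAdd 10 (Fin.castAdd 10 i) : Fin 30) - 10 = Fin.castAdd 20 i := by
    decide
  have h2 : ∀ i : Fin 10, (Fin.natAdd 10 (Fin.natAdd 10 i) : Fin 30) - 10 =
      Fin.natAdd 10 (Fin.castAdd 10 i) := by
    decide
  have h3 : ∀ i : Fin 10, (Fin.castAdd 20 i : Fin 30) - 10 = Fin.natAdd 10 (Fin.natAdd 10 i) := by
    decide
  have hs : ∀ g : Fin 20 → ℕ, ∑ i, g i = ∑ i : Fin 10, g (Fin.castAdd 10 i) +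
      ∑ i : Fin 10, g (Fin.natAdd 10 i) := fun g => Fin.sum_univ_add (a := 10) (b := 10) g
  rw [sum_fin_thirty f]
  simp only [hs, h1, h2, h3]
  ring

/-- Some shift of a word of weight at most six has at most four nonzero entries among the last
twenty ones. -/
theorem exists_shift_tail_le {c : Fin (15 * 2) → F} (hc : hammingNorm c ≤ 6) :
    ∃ k ≤ 15,
      (hammingNorm fun i : Fin 20 => (shiftMap F ^ k) c (Fin.natAdd 10 i : Fin 30)) ≤ 4 := by
  by_contra! h
  have h0 := h 0 (by norm_num)
  have h5 := h 5 (by norm_num)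
  have h10 := h (5 + 5) (by norm_num)
  simp only [pow_zero, Module.End.one_apply, pow_add, Module.End.mul_apply,
    pow_five_shiftMap_apply, hammingNorm, Finset.card_filter] at h0 h5 h10
  have hsum := sum_tail_shifts fun i => if c i ≠ 0 then 1 else 0
  have hnorm : ∑ i : Fin 30, (if c i ≠ 0 then 1 else 0) = hammingNorm c := by
    rw [hammingNorm, Finset.card_filter]
  rw [hnorm] at hsum
  omega

end Shift

/-! ### The code over an arbitrary field with four elements -/

section Code

variable {F : Type*} [Field F]

/-- The rows of the generator matrix over `F`. -/
def codeRow (φ : GF4 ≃+* F) (j : Fin 11) : Fin (15 * 2) → F := fun i => φ (genRow j i)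

/-- The word over `F` with the given symbols in `GF4`. -/
def mapWord (φ : GF4 ≃+* F) (v : Fin 30 → GF4) : Fin (15 * 2) → F := fun i => φ (v i)

theorem herm_mapWord (φ : GF4 ≃+* F) (v u : Fin 30 → GF4) :
    herm (mapWord φ v) (mapWord φ u) = φ (herm v u) :=
  herm_map φ.toRingHom v u

theorem codeRow_eq_mapWord (φ : GF4 ≃+* F) (j : Fin 11) : codeRow φ j = mapWord φ (genRow j) := rfl

/-- The quasi-cyclic code generated by the two words. -/
def theCode (φ : GF4 ≃+* F) : Submodule F (Fin (15 * 2) → F) :=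
  shiftSpan (mapWord φ firstWord) (mapWord φ secondWord)

theorem pow_shiftMap_mapWord (φ : GF4 ≃+* F) (k : ℕ) (v : Fin 30 → GF4) :
    (shiftMap F ^ k) (mapWord φ v) = mapWord φ (rowShift^[k] v) := by
  induction k with
  | zero => rfl
  | succ k ih =>
    rw [pow_succ', Module.End.mul_apply, ih, shiftMap_eq_rowShift, Function.iterate_succ_apply']
    rfl

theorem mapWord_mem_span_codeRow (φ : GF4 ≃+* F) {v : Fin 30 → GF4} {a : Fin 11 → GF4}
    (h : ∀ i, v i = ∑ k, a k * genRow k i) :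
    mapWord φ v ∈ Submodule.span F (Set.range (codeRow φ)) := by
  have : mapWord φ v = ∑ k, φ (a k) • codeRow φ k := by
    funext i
    rw [mapWord, h, map_sum, Finset.sum_apply]
    exact Finset.sum_congr rfl fun k _ => map_mul φ _ _
  rw [this]
  exact Submodule.sum_mem _ fun k _ =>
    Submodule.smul_mem _ _ (Submodule.subset_span ⟨k, rfl⟩)

/-- The generator matrix generates the quasi-cyclic code: its row space is closed under shifts and
contains both words, and its rows are combinations of shifts of these words. -/
theorem theCode_eq_span (φ : GF4 ≃+* F) :
    theCode φ = Submodule.span F (Set.range (codeRow φ)) := by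
  apply le_antisymm
  · refine shiftSpan_le _ _ ?_ (mapWord_mem_span_codeRow φ firstWord_eq_sum_genRow)
      (mapWord_mem_span_codeRow φ secondWord_eq_sum_genRow)
    rw [shiftInvariant_iff]
    intro c hc
    induction hc using Submodule.span_induction with
    | mem c hc =>
      obtain ⟨j, rfl⟩ := hc
      have h := pow_shiftMap_mapWord φ 1 (genRow j)
      rw [pow_one] at h
      rw [codeRow_eq_mapWord, h]
      exact mapWord_mem_span_codeRow φ (rowShift_genRow_eq_sum_genRow j)
    | zero =>
      rw [map_zero]
      exact Submodule.zero_mem _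
    | add c d _ _ hc hd =>
      rw [map_add]
      exact Submodule.add_mem _ hc hd
    | smul r c _ hc =>
      rw [map_smul]
      exact Submodule.smul_mem _ _ hc
  · refine Submodule.span_le.2 ?_
    rintro _ ⟨j, rfl⟩
    have h : codeRow φ j =
        (∑ k : Fin 9, φ (shiftCoeff j (Fin.castAdd 2 k)) •
          (shiftMap F ^ (k : ℕ)) (mapWord φ firstWord)) +
        ∑ k : Fin 2, φ (shiftCoeff j (Fin.natAdd 9 k)) •
          (shiftMap F ^ (k : ℕ)) (mapWord φ secondWord) := by
      funext i
      simp only [pow_shiftMap_mapWord, Pi.add_apply, Finset.sum_apply, Pi.smul_apply, smul_eq_mul,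
        codeRow, genRow_eq_sum_shifts j i, map_add, map_sum, map_mul, mapWord]
    rw [h]
    refine Submodule.add_mem _ (Submodule.sum_mem _ fun k _ => Submodule.smul_mem _ _ ?_)
      (Submodule.sum_mem _ fun k _ => Submodule.smul_mem _ _ ?_)
    · exact pow_shiftMap_mem_left _ _ _
    · exact pow_shiftMap_mem_right _ _ _

theorem genRow_castAdd (j : Fin 11) (i : Fin 10) :
    genRow j (Fin.castAdd 20 i) = if (j : ℕ) = i then 1 else 0 :=
  Fin.addCases_left (m := 10) (n := 20) i

theorem linearIndependent_genRow (f : GF4 →+* F) :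
    LinearIndependent F fun j (i : Fin 30) => f (genRow j i) := by
  rw [Fintype.linearIndependent_iff]
  intro a ha
  have hval : ∀ i, ∑ j, a j * f (genRow j i) = 0 := by
    intro i
    have := congrFun ha i
    rwa [Finset.sum_apply] at this
  have hhead : ∀ j : Fin 10, a j.castSucc = 0 := by
    intro j
    have h := hval (Fin.castAdd 20 j)
    rw [Finset.sum_eq_single j.castSucc] at h
    · rw [genRow_castAdd, Fin.val_castSucc, if_pos rfl, map_one, mul_one] at h
      exact h
    · intro k _ hk
      rw [genRow_castAdd, if_neg (show ¬(k : ℕ) = j from fun h => hk (Fin.ext h)), map_zero,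
        mul_zero]
    · simp
  have hlast : a (Fin.last 10) = 0 := by
    have h := hval 10
    have h1 : genRow (Fin.last 10) 10 = 1 := by decide +kernel
    rw [Fin.sum_univ_castSucc, h1, map_one, mul_one] at h
    simpa only [hhead, zero_mul, Finset.sum_const_zero, zero_add] using h
  exact fun j => Fin.lastCases hlast hhead j

theorem linearIndependent_codeRow (φ : GF4 ≃+* F) : LinearIndependent F (codeRow φ) :=
  linearIndependent_genRow φ.toRingHom

theorem finrank_theCode (φ : GF4 ≃+* F) : Module.finrank F (theCode φ) = 11 := by
  rw [theCode_eq_span, finrank_span_eq_card (linearIndependent_codeRow φ), Fintype.card_fin]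

theorem shiftInvariant_theCode (φ : GF4 ≃+* F) : ShiftInvariant 2 (theCode φ) :=
  shiftInvariant_shiftSpan _ _

theorem codeRow_mem (φ : GF4 ≃+* F) (j : Fin 11) : codeRow φ j ∈ theCode φ := by
  rw [theCode_eq_span]
  exact Submodule.subset_span ⟨j, rfl⟩

theorem exists_eq_sum_of_mem_theCode {φ : GF4 ≃+* F} {c : Fin (15 * 2) → F} (hc : c ∈ theCode φ) :
    ∃ a : Fin 11 → F, c = ∑ j, a j • codeRow φ j := by
  rw [theCode_eq_span] at hc
  obtain ⟨a, ha⟩ := (Submodule.mem_span_range_iff_exists_fun F).1 hc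
  exact ⟨a, ha.symm⟩

theorem mem_hermDual_theCode (φ : GF4 ≃+* F) {v : Fin (15 * 2) → F} :
    v ∈ hermDual 2 (theCode φ) ↔ ∀ j, herm v (codeRow φ j) = 0 := by
  have := charP_two_of_gf4_equiv φ
  rw [theCode_eq_span, mem_hermDual_span]

/-- The dual is the kernel of the matrix of squared rows. -/
theorem finrank_hermDual_theCode (φ : GF4 ≃+* F) :
    Module.finrank F (hermDual 2 (theCode φ)) = 19 := by
  let M : Matrix (Fin 11) (Fin (15 * 2)) F := Matrix.of fun j i => codeRow φ j i ^ 2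
  have hM : LinearIndependent F M.row := by
    have h := linearIndependent_genRow (φ.toRingHom.comp (frobenius GF4 2))
    convert h using 3
    exact (map_pow φ _ 2).symm
  have hker : hermDual 2 (theCode φ) = LinearMap.ker M.mulVecLin := by
    ext v
    rw [mem_hermDual_theCode, LinearMap.mem_ker, Matrix.mulVecLin_apply, funext_iff]
    refine forall_congr' fun j => ?_
    rw [Matrix.mulVec, dotProduct_comm]
    rfl
  have h := LinearMap.finrank_range_add_finrank_ker M.mulVecLin
  have hrank : Module.finrank F (LinearMap.range M.mulVecLin) = 11 := by
    have := hM.rank_matrix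
    rwa [Fintype.card_fin] at this
  rw [hrank, Module.finrank_fin_fun] at h
  rw [hker]
  omega

/-- The Hermitian hull of the code. -/
def theHull (φ : GF4 ≃+* F) : Submodule F (Fin (15 * 2) → F) :=
  theCode φ ⊓ hermDual 2 (theCode φ)

/-- The last row of the generator matrix; it spans a complement of the hull in the code. -/
abbrev lastRow (φ : GF4 ≃+* F) : Fin (15 * 2) → F := codeRow φ (Fin.last 10)

theorem codeRow_castSucc_mem_theHull (φ : GF4 ≃+* F) (j : Fin 10) :
    codeRow φ j.castSucc ∈ theHull φ := by
  refine ⟨codeRow_mem φ _, (mem_hermDual_theCode φ).2 fun k => ?_⟩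
  rw [codeRow_eq_mapWord, codeRow_eq_mapWord, herm_mapWord, herm_genRow_genRow, map_zero]

theorem herm_lastRow_lastRow (φ : GF4 ≃+* F) : herm (lastRow φ) (lastRow φ) = 1 := by
  rw [lastRow, codeRow_eq_mapWord, herm_mapWord, herm_lastRow_self, map_one]

/-- The product of a codeword with the last row is its last coefficient. -/
theorem herm_sum_lastRow (φ : GF4 ≃+* F) (a : Fin 11 → F) :
    herm (∑ j, a j • codeRow φ j) (lastRow φ) = a (Fin.last 10) := by
  rw [← hermLin_apply, map_sum, Fin.sum_univ_castSucc]
  simp only [map_smul, hermLin_apply, herm_lastRow_lastRow]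
  rw [Finset.sum_eq_zero, zero_add, smul_eq_mul, mul_one]
  intro j _
  rw [(mem_hermDual.1 (codeRow_castSucc_mem_theHull φ j).2) _ (codeRow_mem φ _), smul_zero]

theorem theHull_eq_span (φ : GF4 ≃+* F) :
    theHull φ = Submodule.span F (Set.range fun j : Fin 10 => codeRow φ j.castSucc) := by
  apply le_antisymm
  · rintro c ⟨hc, hc'⟩
    obtain ⟨a, rfl⟩ := exists_eq_sum_of_mem_theCode hc
    have h := (mem_hermDual_theCode φ).1 hc' (Fin.last 10)
    rw [herm_sum_lastRow] at h
    rw [Fin.sum_univ_castSucc, h, zero_smul, add_zero]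
    exact Submodule.sum_mem _ fun j _ =>
      Submodule.smul_mem _ _ (Submodule.subset_span ⟨j, rfl⟩)
  · refine Submodule.span_le.2 ?_
    rintro _ ⟨j, rfl⟩
    exact codeRow_castSucc_mem_theHull φ j

theorem finrank_theHull (φ : GF4 ≃+* F) : Module.finrank F (theHull φ) = 10 := by
  rw [theHull_eq_span]
  exact (finrank_span_eq_card ((linearIndependent_codeRow φ).comp _
    (Fin.castSucc_injective 10))).trans (Fintype.card_fin 10)

theorem mem_hermDual_theHull (φ : GF4 ≃+* F) {v : Fin (15 * 2) → F} :
    v ∈ hermDual 2 (theHull φ) ↔ ∀ j : Fin 10, herm v (codeRow φ j.castSucc) = 0 := by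
  have := charP_two_of_gf4_equiv φ
  rw [theHull_eq_span, mem_hermDual_span]

theorem mem_hermDual_theCode_iff (φ : GF4 ≃+* F) {v : Fin (15 * 2) → F}
    (hv : v ∈ hermDual 2 (theHull φ)) :
    v ∈ hermDual 2 (theCode φ) ↔ herm v (lastRow φ) = 0 := by
  rw [mem_hermDual_theCode]
  refine ⟨fun h => h _, fun h j => ?_⟩
  exact Fin.lastCases h ((mem_hermDual_theHull φ).1 hv) j

theorem theCode_sup_hermDual_le (φ : GF4 ≃+* F) :
    theCode φ ⊔ hermDual 2 (theCode φ) ≤ hermDual 2 (theHull φ) := by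
  refine sup_le (fun v hv => ?_) fun v hv => ?_
  · exact mem_hermDual.2 fun u hu => herm_eq_zero_comm φ (hu.2 v hv)
  · exact mem_hermDual.2 fun u hu => hv u hu.1

theorem wordSix_mem (φ : GF4 ≃+* F) : mapWord φ wordSix ∈ hermDual 2 (theHull φ) :=
  (mem_hermDual_theHull φ).2 fun j => by
    rw [codeRow_eq_mapWord, herm_mapWord, herm_wordSix_genRow, map_zero]

theorem wordSeven_mem (φ : GF4 ≃+* F) : mapWord φ wordSeven ∈ hermDual 2 (theCode φ) :=
  (mem_hermDual_theCode φ).2 fun j => by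
    rw [codeRow_eq_mapWord, herm_mapWord, herm_wordSeven_genRow, map_zero]

theorem herm_cons {n : ℕ} (b b' : F) (y y' : Fin n → F) :
    herm (Fin.cons b y : Fin (n + 1) → F) (Fin.cons b' y') = b * b' ^ 2 + herm y y' := by
  rw [herm, Fin.sum_univ_succ]
  rfl

/-- The words orthogonal to the hull, extended by their product with the last row, form a code of
minimum distance at least seven. -/
theorem seven_le_hammingNorm [DecidableEq F] (φ : GF4 ≃+* F) {v : Fin (15 * 2) → F}
    (hv : v ∈ hermDual 2 (theHull φ)) (hv0 : v ≠ 0) :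
    7 ≤ hammingNorm v + if herm v (lastRow φ) ≠ 0 then 1 else 0 := by
  by_contra! hlt
  obtain ⟨k, hk, htail⟩ := exists_shift_tail_le (c := v) (by omega)
  have hcode := shiftInvariant_hermDual (shiftInvariant_theCode φ)
  have hhull := shiftInvariant_hermDual (shiftInvariant_inf (shiftInvariant_theCode φ) hcode)
  set v' := (shiftMap F ^ k) v with hv'
  have hv'mem : v' ∈ hermDual 2 (theHull φ) := pow_shiftMap_mem hhull k hv
  have hiff : herm v' (lastRow φ) = 0 ↔ herm v (lastRow φ) = 0 := by
    rw [← mem_hermDual_theCode_iff φ hv'mem, ← mem_hermDual_theCode_iff φ hv,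
      pow_shiftMap_mem_iff hcode hk]
  have hnorm : hammingNorm v' = hammingNorm v := hammingNorm_pow_shiftMap k v
  let y : Fin 30 → GF4 := fun i => φ.symm (v' i)
  have hy : mapWord φ y = v' := by
    funext i
    exact φ.apply_symm_apply _
  have hherm : ∀ j, herm v' (codeRow φ j) = φ (herm y (genRow j)) := by
    intro j
    rw [← hy, codeRow_eq_mapWord, herm_mapWord]
  have hwt : ∀ {n : ℕ} (s : Fin n → Fin 30), (hammingNorm fun i => y (s i)) =
      hammingNorm fun i => v' (s i) := fun s =>
    hammingNorm_comp (fun _ => φ.symm) (fun _ => φ.symm.injective) fun _ => map_zero φ.symm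
  have h := seven_le_of_tail_le (v := y) ?_ ?_ ?_
  · have h1 : hammingNorm y = hammingNorm v' := hwt id
    have h2 : herm y (genRow (Fin.last 10)) = 0 ↔ herm v (lastRow φ) = 0 := by
      rw [← hiff, hherm, map_eq_zero_iff φ φ.injective]
    rw [h1, hnorm] at h
    simp only [ne_eq, h2] at h
    exact absurd h (not_le.2 hlt)
  · intro j
    have := (mem_hermDual_theHull φ).1 hv'mem j
    rwa [hherm, map_eq_zero_iff φ φ.injective] at this
  · intro h0
    apply hv0
    rw [← hammingNorm_eq_zero, ← hnorm, ← hy, h0, hammingNorm_eq_zero]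
    funext i
    exact map_zero φ
  · rw [hwt]
    exact htail

theorem hammingNorm_mapWord [DecidableEq F] (φ : GF4 ≃+* F) (v : Fin 30 → GF4) :
    hammingNorm (mapWord φ v) = hammingNorm v :=
  hammingNorm_comp (fun _ => φ) (fun _ => φ.injective) fun _ => map_zero φ

theorem ne_zero_of_hammingNorm_pos [DecidableEq F] {v : Fin (15 * 2) → F}
    (h : 0 < hammingNorm v) : v ≠ 0 :=
  hammingNorm_pos_iff.1 h

theorem wordSix_notMem_theCode (φ : GF4 ≃+* F) : mapWord φ wordSix ∉ theCode φ := by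
  intro h
  have h1 := herm_eq_zero_comm φ (wordSeven_mem φ _ h)
  rw [herm_mapWord, map_eq_zero_iff φ φ.injective] at h1
  exact herm_wordSix_wordSeven h1

theorem hasMinDist_hermDual_theCode [DecidableEq F] (φ : GF4 ≃+* F) :
    HasMinDist (hermDual 2 (theCode φ)) 7 := by
  have hseven : hammingNorm (mapWord φ wordSeven) = 7 := by
    rw [hammingNorm_mapWord, hammingNorm_wordSeven]
  refine ⟨⟨_, wordSeven_mem φ, ne_zero_of_hammingNorm_pos (by omega), hseven⟩, ?_⟩
  rintro w ⟨c, hc, hc0, rfl⟩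
  have hc' := theCode_sup_hermDual_le φ (Submodule.mem_sup_right hc)
  have h := seven_le_hammingNorm φ hc' hc0
  rwa [if_neg (not_not.2 ((mem_hermDual_theCode_iff φ hc').1 hc)), add_zero] at h

theorem wordSix_mem_sup (φ : GF4 ≃+* F) :
    mapWord φ wordSix ∈ theCode φ ⊔ hermDual 2 (theCode φ) := by
  set v := mapWord φ wordSix with hv
  -- subtracting the component along the last row leaves a word of the dual
  have hmem : v - herm v (lastRow φ) • lastRow φ ∈ hermDual 2 (theCode φ) := by
    have hU : lastRow φ ∈ hermDual 2 (theHull φ) :=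
      theCode_sup_hermDual_le φ (Submodule.mem_sup_left (codeRow_mem φ _))
    rw [mem_hermDual_theCode_iff φ
      (Submodule.sub_mem _ (wordSix_mem φ) (Submodule.smul_mem _ _ hU)), ← hermLin_apply, map_sub,
      map_smul, hermLin_apply, hermLin_apply, herm_lastRow_lastRow, smul_eq_mul, mul_one, sub_self]
  have hsum : v = herm v (lastRow φ) • lastRow φ + (v - herm v (lastRow φ) • lastRow φ) := by
    rw [add_sub_cancel]
  rw [hsum]
  exact Submodule.add_mem_sup (Submodule.smul_mem _ _ (codeRow_mem φ _)) hmem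

theorem six_le_hammingNorm [DecidableEq F] (φ : GF4 ≃+* F) {v : Fin (15 * 2) → F}
    (hv : v ∈ hermDual 2 (theHull φ)) (hv0 : v ≠ 0) : 6 ≤ hammingNorm v := by
  have h := seven_le_hammingNorm φ hv hv0
  split_ifs at h <;> omega

theorem hammingNorm_mapWord_wordSix [DecidableEq F] (φ : GF4 ≃+* F) :
    hammingNorm (mapWord φ wordSix) = 6 := by
  rw [hammingNorm_mapWord, hammingNorm_wordSix]

theorem hasMinDist_sup [DecidableEq F] (φ : GF4 ≃+* F) :
    HasMinDist (theCode φ ⊔ hermDual 2 (theCode φ)) 6 := by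
  have hsix := hammingNorm_mapWord_wordSix φ
  refine ⟨⟨_, wordSix_mem_sup φ, ne_zero_of_hammingNorm_pos (by omega), hsix⟩, ?_⟩
  rintro w ⟨c, hc, hc0, rfl⟩
  exact six_le_hammingNorm φ (theCode_sup_hermDual_le φ hc) hc0

/-! ### The quantum codes -/

/-- The hull itself, whose dual has minimum distance six. -/
theorem exists_isAdditiveCode_thirty [DecidableEq F] (φ : GF4 ≃+* F) :
    ∃ S, IsAdditiveCode 30 10 6 S := by
  refine exists_isAdditiveCode (n := 30) φ (S := theHull φ) ?_ ?_ ?_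
  · exact fun v hv => theCode_sup_hermDual_le φ (Submodule.mem_sup_left hv.1)
  · change 2 * Module.finrank F (theHull φ) + 10 = 30
    rw [finrank_theHull]
  · refine ⟨⟨_, wordSix_mem φ, fun h => wordSix_notMem_theCode φ h.1,
      hammingNorm_mapWord_wordSix φ⟩, ?_⟩
    rintro w ⟨v, hv, hvS, rfl⟩
    exact six_le_hammingNorm φ hv fun h0 => hvS (h0 ▸ Submodule.zero_mem _)

/-- A word in front of which its product with the last row is put. -/
def extendWord (φ : GF4 ≃+* F) : (Fin (15 * 2) → F) →ₗ[F] (Fin 31 → F) where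
  toFun c := Fin.cons (herm c (lastRow φ)) c
  map_add' c d := by
    rw [← hermLin_apply, map_add]
    funext i
    refine Fin.cases ?_ (fun j => ?_) i <;> rfl
  map_smul' r c := by
    rw [← hermLin_apply, map_smul]
    funext i
    refine Fin.cases ?_ (fun j => ?_) i <;> rfl

theorem extendWord_injective (φ : GF4 ≃+* F) : Function.Injective (extendWord φ) := by
  intro c d h
  have h' : (Fin.cons (herm c (lastRow φ)) c : Fin 31 → F) = Fin.cons (herm d (lastRow φ)) d := h
  exact (Fin.cons_inj.1 h').2

theorem hammingNorm_cons [DecidableEq F] {n : ℕ} (b : F) (y : Fin n → F) :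
    hammingNorm (Fin.cons b y : Fin (n + 1) → F) = (if b ≠ 0 then 1 else 0) + hammingNorm y := by
  rw [hammingNorm, Fin.card_filter_univ_succ']
  rfl

/-- The dual of the extended code consists of the extensions of the words orthogonal to the
hull. -/
theorem mem_hermDual_map_extendWord (φ : GF4 ≃+* F) {b : F} {y : Fin (15 * 2) → F} :
    (Fin.cons b y : Fin 31 → F) ∈ hermDual 2 ((theCode φ).map (extendWord φ)) ↔
      y ∈ hermDual 2 (theHull φ) ∧ b = herm y (lastRow φ) := by
  have := charP_two_of_gf4_equiv φ
  rw [mem_hermDual]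
  constructor
  · intro h
    have h' : ∀ c ∈ theCode φ, b * herm c (lastRow φ) ^ 2 + herm y c = 0 := by
      intro c hc
      have := h _ ⟨c, hc, rfl⟩
      rwa [extendWord, LinearMap.coe_mk, AddHom.coe_mk, herm_cons] at this
    constructor
    · rw [mem_hermDual_theHull]
      intro j
      have hj := codeRow_castSucc_mem_theHull φ j
      have h1 := h' _ hj.1
      have h2 : herm (codeRow φ j.castSucc) (lastRow φ) = 0 := hj.2 _ (codeRow_mem φ _)
      rwa [h2, zero_pow two_ne_zero, mul_zero, zero_add] at h1
    · have h1 := h' _ (codeRow_mem φ (Fin.last 10))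
      rwa [herm_lastRow_lastRow, one_pow, mul_one, CharTwo.add_eq_zero] at h1
  · rintro ⟨hy, rfl⟩ _ ⟨c, hc, rfl⟩
    rw [extendWord, LinearMap.coe_mk, AddHom.coe_mk, herm_cons]
    obtain ⟨a, rfl⟩ := exists_eq_sum_of_mem_theCode hc
    rw [herm_sum_lastRow, CharTwo.add_eq_zero, Fin.sum_univ_castSucc, herm_add_right,
      herm_smul_right, mul_comm, eq_comm, add_eq_right]
    refine hy _ ?_
    rw [theHull_eq_span]
    exact Submodule.sum_mem _ fun j _ =>
      Submodule.smul_mem _ _ (Submodule.subset_span ⟨j, rfl⟩)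

/-- Lengthening the code by one symbol makes it self-orthogonal, as the added symbol compensates the
norm of the last row. -/
theorem exists_isAdditiveCode_thirtyOne [DecidableEq F] (φ : GF4 ≃+* F) :
    ∃ S, IsAdditiveCode 31 9 7 S := by
  refine exists_isAdditiveCode φ (S := (theCode φ).map (extendWord φ)) ?_ ?_ ?_
  · rintro _ ⟨c, hc, rfl⟩
    exact (mem_hermDual_map_extendWord φ).2
      ⟨theCode_sup_hermDual_le φ (Submodule.mem_sup_left hc), rfl⟩
  · rw [← (Submodule.equivMapOfInjective _ (extendWord_injective φ) _).finrank_eq, finrank_theCode]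
  · have hsix := hammingNorm_mapWord_wordSix φ
    have hne : mapWord φ wordSix ≠ 0 := ne_zero_of_hammingNorm_pos (by omega)
    refine ⟨⟨extendWord φ (mapWord φ wordSix), (mem_hermDual_map_extendWord φ).2
      ⟨wordSix_mem φ, rfl⟩, ?_, ?_⟩, ?_⟩
    · rintro ⟨c, hc, h⟩
      exact wordSix_notMem_theCode φ (extendWord_injective φ h ▸ hc)
    · have h7 := seven_le_hammingNorm φ (wordSix_mem φ) hne
      refine (hammingNorm_cons _ _).trans ?_
      split_ifs at h7 ⊢ <;> omega
    · rintro w ⟨v, hv, hvS, rfl⟩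
      obtain ⟨b, y, rfl⟩ : ∃ b y, v = Fin.cons b y := ⟨v 0, Fin.tail v, by simp⟩
      obtain ⟨hy, rfl⟩ := (mem_hermDual_map_extendWord φ).1 hv
      rw [hammingNorm_cons, add_comm]
      refine seven_le_hammingNorm φ hy ?_
      rintro rfl
      exact hvS ⟨0, Submodule.zero_mem _, rfl⟩

end Code

/-! ### The factorization of `x ^ 15 - 1` -/

section Factors

/-- The product of the nine factors, evaluated at `y`. -/
theorem prod_factor_eval {R : Type*} [CommRing R] {Z y : R} (hZ : Z ^ 2 + Z + 1 = 0)
    (h2 : (2 : R) = 0) :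
    (y + 1) * (y ^ 2 + Z * y + 1) * (y ^ 2 + Z ^ 2 * y + 1) * (y + Z) * (y + Z ^ 2) *
      (y ^ 2 + y + Z) * (y ^ 2 + Z ^ 2 * y + Z ^ 2) * (y ^ 2 + y + Z ^ 2) *
      (y ^ 2 + Z * y + Z) = y ^ 15 - 1 := by
  have h₁ : (y + 1) * (y + Z) * (y + Z ^ 2) = y ^ 3 + 1 := by
    linear_combination ((y + 1) * (y + (Z - 1))) * hZ
  have h₂ : (y ^ 2 + Z * y + 1) * (y ^ 2 + Z ^ 2 * y + 1) = y ^ 4 + y ^ 3 + y ^ 2 + y + 1 := by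
    linear_combination (y ^ 3 + (Z - 1) * y ^ 2 + y) * hZ + (-y ^ 3 + y ^ 2 - y) * h2
  have h₃ : (y ^ 2 + y + Z) * (y ^ 2 + y + Z ^ 2) = y ^ 4 + y + 1 := by
    linear_combination (y ^ 2 + y + Z - 1) * hZ + (y ^ 3 - y) * h2
  have h₄ : (y ^ 2 + Z ^ 2 * y + Z ^ 2) * (y ^ 2 + Z * y + Z) = y ^ 4 + y ^ 3 + 1 := by
    linear_combination (y ^ 3 + y ^ 2 + (Z - 1) * y ^ 2 + 2 * (Z - 1) * y + (Z - 1)) * hZ +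
      (-y ^ 3 + y) * h2
  have h₅ : (y ^ 3 + 1) * (y ^ 4 + y ^ 3 + y ^ 2 + y + 1) * (y ^ 4 + y + 1) * (y ^ 4 + y ^ 3 + 1) =
      y ^ 15 - 1 := by
    linear_combination (1 + y + y ^ 2 + 2 * y ^ 3 + 4 * y ^ 4 + 4 * y ^ 5 + 4 * y ^ 6 + 6 * y ^ 7 +
      6 * y ^ 8 + 4 * y ^ 9 + 4 * y ^ 10 + 4 * y ^ 11 + 2 * y ^ 12 + y ^ 13 + y ^ 14) * h2
  rw [← h₅, ← h₁, ← h₂, ← h₃, ← h₄]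
  ring

variable {F : Type*} [Field F]

theorem prod_factor [CharP F 2] {z : F} (hz : IsPrimitiveRoot z 3) :
    (X ^ 15 - 1 : F[X]) = ∏ i, factor z i := by
  have hZ : (C z : F[X]) ^ 2 + C z + 1 = 0 := by
    have := congrArg C (primitive_cube_root hz)
    simpa only [map_add, map_pow, map_one, map_zero] using this
  rw [← prod_factor_eval hZ CharTwo.two_eq_zero]
  simp only [Fin.prod_univ_succ, factor, Matrix.cons_val_zero, Matrix.cons_val_succ, map_pow,
    Fin.prod_univ_zero]
  ring

theorem irreducible_quadratic {b c : F} (h : ∀ y, y ^ 2 + b * y + c ≠ 0) :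
    Irreducible (X ^ 2 + C b * X + C c) := by
  have hdeg : (X ^ 2 + C b * X + C c : F[X]).natDegree = 2 := by
    have := natDegree_quadratic (a := 1) (b := b) (c := c) one_ne_zero
    rwa [map_one, one_mul] at this
  rw [irreducible_iff_roots_eq_zero_of_degree_le_three (by omega) (by omega),
    Multiset.eq_zero_iff_forall_notMem]
  intro y hy
  have := (mem_roots'.1 hy).2
  simp only [IsRoot, eval_add, eval_pow, eval_X, eval_mul, eval_C] at this
  exact h y this

theorem irreducible_X_add_C' (a : F) : Irreducible (X + C a) := by
  have := irreducible_X_sub_C (-a)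
  rwa [map_neg, sub_neg_eq_add] at this

theorem irreducible_factor (φ : GF4 ≃+* F) (i : Fin 9) : Irreducible (factor (φ GF4.w) i) := by
  have hquad : ∀ b c : GF4, (∀ y, y ^ 2 + b * y + c ≠ 0) →
      Irreducible (X ^ 2 + C (φ b) * X + C (φ c)) := by
    intro b c h
    refine irreducible_quadratic fun y hy => h (φ.symm y) ?_
    rw [← map_eq_zero_iff φ φ.injective, ← hy]
    simp
  have h₁ := irreducible_X_add_C' (1 : F)
  have h₂ := hquad GF4.w 1 (by decide)
  have h₃ := hquad (GF4.w ^ 2) 1 (by decide)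
  have h₄ := hquad 1 GF4.w (by decide)
  have h₅ := hquad (GF4.w ^ 2) (GF4.w ^ 2) (by decide)
  have h₆ := hquad 1 (GF4.w ^ 2) (by decide)
  have h₇ := hquad GF4.w GF4.w (by decide)
  simp only [map_one, one_mul, map_pow φ] at h₁ h₂ h₃ h₄ h₅ h₆ h₇
  fin_cases i
  · exact h₁
  · exact h₂
  · exact h₃
  · exact irreducible_X_add_C' _
  · exact irreducible_X_add_C' _
  · exact h₄
  · exact h₅
  · exact h₆
  · exact h₇

theorem pairwise_isCoprime_factor [CharP F 2] {z : F} (hz : IsPrimitiveRoot z 3) :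
    Pairwise (Function.onFun IsCoprime (factor z)) := by
  have h15 : ((15 : ℕ) : F) ≠ 0 := by
    rw [CharTwo.natCast_eq_ite, if_neg (by decide)]
    exact one_ne_zero
  have hsep : (∏ i, factor z i).Separable := by
    rw [← prod_factor hz]
    exact X_pow_sub_one_separable_iff.2 h15
  intro i j hij
  have hdvd : factor z i * factor z j ∣ ∏ i, factor z i := by
    rw [← Finset.prod_pair hij]
    exact Finset.prod_dvd_prod_of_subset _ _ _ (Finset.subset_univ _)
  exact (hsep.of_dvd hdvd).isCoprime

end Factors

/-! ### Points of the extension field -/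

section Points

variable {F K : Type*} [Field F] [Field K] [Algebra F K]

/-- A field with sixteen elements over `F` is a quotient of `GF16`, compatibly with the subfields
with four elements. -/
theorem exists_gf16_hom (hK : Nat.card K = 16) (φ : GF4 ≃+* F) {x : K}
    (hx : x ^ 2 + x + algebraMap F K (φ GF4.w) = 0) :
    ∃ ψ : GF16 →+* K, Function.Surjective ψ ∧ ψ GF16.xi = x ∧
      ∀ r, ψ (algebraMap GF4 GF16 r) = algebraMap F K (φ r) := by
  have := charP_two_of_gf4_equiv φ
  have : CharP K 2 := charP_of_injective_algebraMap (algebraMap F K).injective 2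
  let f : GF4 →+* K := (algebraMap F K).comp φ.toRingHom
  have hu : x * x = f GF4.w + f 1 * x := by
    rw [map_one]
    change x * x = algebraMap F K (φ GF4.w) + 1 * x
    linear_combination hx - (x + algebraMap F K (φ GF4.w)) * CharTwo.two_eq_zero (R := K)
  let ψ : GF16 →+* K := quadHom f x hu
  refine ⟨ψ, ?_, ?_, ?_⟩
  · have hinj : Function.Injective ψ := by
      rw [injective_iff_map_eq_zero]
      intro a ha
      by_contra h0
      have h1 : ∀ p q : GF4, (⟨p, q⟩ : GF16) ≠ 0 → ∃ r s : GF4, (⟨p, q⟩ : GF16) * ⟨r, s⟩ = 1 := by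
        decide +kernel
      obtain ⟨r, s, hb⟩ := h1 a.re a.im h0
      have := congrArg ψ hb
      rw [map_mul, map_one] at this
      change ψ a * _ = 1 at this
      rw [ha, zero_mul] at this
      exact zero_ne_one this
    have : Finite K := Nat.finite_of_card_ne_zero (by omega)
    refine ((Nat.bijective_iff_injective_and_card ψ).2 ⟨hinj, ?_⟩).2
    rw [hK, Nat.card_congr (QuadraticAlgebra.equivProd GF4.w 1), Nat.card_prod,
      Nat.card_eq_fintype_card]
    decide
  · simp [ψ, quadHom_apply, GF16.xi]
  · intro r
    simp [ψ, quadHom_apply, f]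

theorem evalAt_mapWord {B A : Type*} [CommRing B] [CommRing A] [Algebra F A] (φ : GF4 ≃+* F)
    (f : GF4 →+* B) (ρ : B →+* A) (hρ : ∀ r, ρ (f r) = algebraMap F A (φ r))
    (v : Fin 30 → GF4) (b : B) (t : Fin 2) :
    evalAt 15 2 (ρ b) (mapWord φ v) t = ρ (columnValue f v t b) := by
  rw [evalAt_apply, columnValue, map_sum]
  refine Finset.sum_congr rfl fun g _ => ?_
  rw [map_mul, hρ, map_pow, Algebra.smul_def]
  rfl

theorem constituent_theCode {B A : Type*} [CommRing B] [Field A] [Algebra F A] (φ : GF4 ≃+* F)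
    (f : GF4 →+* B) (ρ : B →+* A) (hρ : ∀ r, ρ (f r) = algebraMap F A (φ r)) {b : B}
    (hb : ρ b ^ 15 = 1) {u u' : Fin 2 → B} (hu : ∀ t, columnValue f firstWord t b = u t)
    (hu' : ∀ t, columnValue f secondWord t b = u' t) :
    constituent 15 2 (ρ b) (theCode φ) =
      Submodule.span A {fun t => ρ (u t), fun t => ρ (u' t)} := by
  rw [theCode, constituent_shiftSpan _ _ hb]
  congr 2
  · funext t
    rw [evalAt_mapWord φ f ρ hρ, hu]
  · congr 1
    funext t
    rw [evalAt_mapWord φ f ρ hρ, hu']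

/-- The points with a nontrivial `ξ`-coordinate generate the extension. -/
theorem exists_aeval_eq {φ : GF4 ≃+* F} {ψ : GF16 →+* K} (hψ : Function.Surjective ψ)
    (hC : ∀ r, ψ (algebraMap GF4 GF16 r) = algebraMap F K (φ r)) {b : GF16}
    (hb : ∀ p q : GF4, ∃ r s, (⟨p, q⟩ : GF16) = algebraMap GF4 GF16 r + algebraMap GF4 GF16 s * b)
    (y : K) : ∃ p : F[X], aeval (ψ b) p = y := by
  obtain ⟨a, rfl⟩ := hψ y
  obtain ⟨r, s, h⟩ := hb a.re a.im
  refine ⟨C (φ r) + C (φ s) * X, ?_⟩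
  rw [map_add, map_mul, aeval_C, aeval_C, aeval_X, ← hC, ← hC, ← map_mul, ← map_add, ← h]

end Points

section Constituents

variable {F K : Type*} [Field F] [Field K] [Algebra F K]

theorem aeval_point_factor {φ : GF4 ≃+* F} {ψ : GF16 →+* K}
    (hC : ∀ r, ψ (algebraMap GF4 GF16 r) = algebraMap F K (φ r)) (i : Fin 9) :
    aeval (point (φ GF4.w) (ψ GF16.xi) i) (factor (φ GF4.w) i) = 0 := by
  have hquad : ∀ (y : GF16) (b c : GF4),
      y ^ 2 + algebraMap GF4 GF16 b * y + algebraMap GF4 GF16 c = 0 →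
      aeval (ψ y) (X ^ 2 + C (φ b) * X + C (φ c) : F[X]) = 0 := by
    intro y b c h
    have := congrArg ψ h
    simpa only [map_add, map_mul, map_pow, hC, map_zero, aeval_X, aeval_C] using this
  have hlin : ∀ a : F, aeval (algebraMap F K a) (X + C a) = 0 := by
    have := charP_two_of_gf4_equiv φ
    intro a
    rw [map_add, aeval_X, aeval_C, ← map_add, CharTwo.add_self_eq_zero, map_zero]
  have h₁ := hlin 1
  have h₂ := hquad (GF16.xi ^ 6) GF4.w 1 (by decide +kernel)
  have h₃ := hquad (GF16.xi ^ 3) (GF4.w ^ 2) 1 (by decide +kernel)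
  have h₄ := hquad GF16.xi 1 GF4.w (by decide +kernel)
  have h₅ := hquad (GF16.xi ^ 11) (GF4.w ^ 2) (GF4.w ^ 2) (by decide +kernel)
  have h₆ := hquad (GF16.xi ^ 2) 1 (GF4.w ^ 2) (by decide +kernel)
  have h₇ := hquad (GF16.xi ^ 7) GF4.w GF4.w (by decide +kernel)
  rw [map_pow] at h₂ h₃ h₅ h₆ h₇
  simp only [map_one, one_mul, map_pow φ] at h₁ h₂ h₃ h₄ h₅ h₆ h₇
  fin_cases i
  · exact h₁
  · exact h₂
  · exact h₃
  · exact hlin _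
  · exact hlin _
  · exact h₄
  · exact h₅
  · exact h₆
  · exact h₇

theorem hasConstituents_theCode {φ : GF4 ≃+* F} {ψ : GF16 →+* K}
    (hC : ∀ r, ψ (algebraMap GF4 GF16 r) = algebraMap F K (φ r)) (h15 : ψ GF16.xi ^ 15 = 1) :
    HasConstituents (φ GF4.w) (ψ GF16.xi) (theCode φ) := by
  have hpow : ∀ k, ψ (GF16.xi ^ k) ^ 15 = 1 := by
    intro k
    rw [map_pow, ← pow_mul, mul_comm, pow_mul, h15, one_pow]
  have hF : ∀ b : GF4, b ^ 15 = 1 → φ.toRingHom b ^ 15 = 1 := by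
    intro b hb
    rw [← map_pow, hb, map_one]
  -- the constituents over `K` and over `F`, from a table of values
  have cK := fun {b : GF16} {u u' : Fin 2 → GF16} (hb : ψ b ^ 15 = 1)
      (hu : ∀ t, columnValue (algebraMap GF4 GF16) firstWord t b = u t)
      (hu' : ∀ t, columnValue (algebraMap GF4 GF16) secondWord t b = u' t) =>
    constituent_theCode φ (algebraMap GF4 GF16) ψ hC hb hu hu'
  have cF := fun {b : GF4} {u u' : Fin 2 → GF4} (hb : b ^ 15 = 1)
      (hu : ∀ t, columnValue (RingHom.id GF4) firstWord t b = u t)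
      (hu' : ∀ t, columnValue (RingHom.id GF4) secondWord t b = u' t) =>
    constituent_theCode (A := F) φ (RingHom.id GF4) φ.toRingHom (fun _ => rfl) (hF b hb) hu hu'
  have vK := xi_pow_values
  have vF := firstWord_values_small
  have vF' := secondWord_values_small
  have pairK : ∀ a b : GF16, (fun t => ψ (![a, b] t)) = ![ψ a, ψ b] := by
    intro a b
    funext t
    fin_cases t <;> rfl
  have pairF : ∀ a b : GF4, (fun t => φ.toRingHom (![a, b] t)) = ![φ a, φ b] := by
    intro a b
    funext t
    fin_cases t <;> rfl
  have zeroK : (fun _ : Fin 2 => ψ 0) = 0 := funext fun _ => map_zero ψ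
  have zeroF : (fun _ : Fin 2 => φ.toRingHom 0) = 0 := funext fun _ => map_zero φ
  refine ⟨?_, ?_, ?_, ?_, ?_, ?_, ?_, ?_, ?_⟩
  · have h := cF (b := 1) (by decide) vF.1 (u' := 0) vF'.1
    simp only [Pi.zero_apply, zeroF, pairF] at h
    simp only [map_one, map_zero] at h
    rw [h, Set.pair_comm, Submodule.span_insert_zero]
  · have h := cK (hpow 6) (u := 0) (u' := 0) (fun t => (vK t).1.1) fun t => (vK t).1.2
    simp only [Pi.zero_apply, zeroK, map_pow] at h
    rw [h, Submodule.span_insert_zero, Submodule.span_zero_singleton]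
  · have h := cK (hpow 3) (u' := 0) (fun t => (vK t).2.1.1) fun t => (vK t).2.1.2
    simp only [Pi.zero_apply, zeroK, pairK, map_pow, map_one] at h
    rw [h, Set.pair_comm, Submodule.span_insert_zero]
  · have h := cF (b := GF4.w) (by decide) vF.2.1 (u' := 0) vF'.2.1
    simp only [Pi.zero_apply, zeroF, pairF, map_one] at h
    exact h.trans (by rw [Set.pair_comm, Submodule.span_insert_zero])
  · have h := cF (b := GF4.w ^ 2) (by decide) vF.2.2 (u' := 0) vF'.2.2
    simp only [Pi.zero_apply, zeroF, pairF, map_one, map_pow] at h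
    exact h.trans (by rw [Set.pair_comm, Submodule.span_insert_zero])
  · have h := cK (b := GF16.xi) h15 (u' := 0) (fun t => (vK t).2.2.1.1) fun t => (vK t).2.2.1.2
    simp only [Pi.zero_apply, zeroK, pairK, map_one] at h
    rw [h, Set.pair_comm, Submodule.span_insert_zero]
  · have h := cK (hpow 11) (fun t => (vK t).2.2.2.1.1) fun t => (vK t).2.2.2.1.2
    simp only [pairK, map_one, map_zero, map_pow] at h
    rw [h, eq_top_iff]
    intro v _
    refine Submodule.mem_span_pair.2 ⟨v 0, v 1, ?_⟩
    funext t
    fin_cases t <;> simp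
  · have h := cK (hpow 2) (u := 0) (u' := 0) (fun t => (vK t).2.2.2.2.1.1)
      fun t => (vK t).2.2.2.2.1.2
    simp only [Pi.zero_apply, zeroK, map_pow] at h
    rw [h, Submodule.span_insert_zero, Submodule.span_zero_singleton]
  · have h := cK (hpow 7) (u := 0) (u' := 0) (fun t => (vK t).2.2.2.2.2.1)
      fun t => (vK t).2.2.2.2.2.2
    simp only [Pi.zero_apply, zeroK, map_pow] at h
    rw [h, Submodule.span_insert_zero, Submodule.span_zero_singleton]

/-- A quasi-cyclic code is contained in every quasi-cyclic code with the same constituents. -/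
theorem le_of_hasConstituents {φ : GF4 ≃+* F} (hz : IsPrimitiveRoot (φ GF4.w) 3) {ψ : GF16 →+* K}
    (hψ : Function.Surjective ψ) (hC : ∀ r, ψ (algebraMap GF4 GF16 r) = algebraMap F K (φ r))
    (h15 : ψ GF16.xi ^ 15 = 1) {D D' : Submodule F (Fin (15 * 2) → F)}
    (hD' : ShiftInvariant 2 D') (hconst : HasConstituents (φ GF4.w) (ψ GF16.xi) D)
    (hconst' : HasConstituents (φ GF4.w) (ψ GF16.xi) D') : D ≤ D' := by
  have := charP_two_of_gf4_equiv φ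
  intro c hc
  refine mem_of_aeval_cofactor_mem hD' (pairwise_isCoprime_factor hz) fun i => ?_
  have hfg : factor (φ GF4.w) i * ∏ j ∈ {i}ᶜ, factor (φ GF4.w) j = X ^ 15 - 1 := by
    rw [prod_factor hz, Fintype.prod_eq_mul_prod_compl i]
  have hirr := irreducible_factor φ i
  have haf := aeval_point_factor hC i
  have hpow : ∀ k, (ψ GF16.xi ^ k) ^ 15 = 1 := by
    intro k
    rw [← pow_mul, mul_comm, pow_mul, h15, one_pow]
  have genF : ∀ a y : F, ∃ p : F[X], aeval a p = y := fun a y => ⟨C y, by rw [aeval_C]; rfl⟩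
  have hlin : ∀ a : F, aeval a (X + C a) = 0 := by
    intro a
    rw [map_add, aeval_X, aeval_C]
    exact CharTwo.add_self_eq_zero a
  have hz15 : φ GF4.w ^ 15 = 1 := by
    rw [← map_pow, show GF4.w ^ 15 = 1 by decide, map_one]
  have genK : ∀ k, (∀ p q : GF4, ∃ r s, (⟨p, q⟩ : GF16) =
      algebraMap GF4 GF16 r + algebraMap GF4 GF16 s * GF16.xi ^ k) →
      ∀ y : K, ∃ p : F[X], aeval (ψ GF16.xi ^ k) p = y := by
    intro k hk
    rw [← map_pow]
    exact exists_aeval_eq hψ hC hk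
  obtain ⟨c₀, c₁, c₂, c₃, c₄, c₅, c₆, c₇, c₈⟩ := hconst
  obtain ⟨d₀, d₁, d₂, d₃, d₄, d₅, d₆, d₇, d₈⟩ := hconst'
  fin_cases i
  · refine aeval_cofactor_mem (a := (1 : F)) hD' (one_pow _) (genF 1) hfg hirr ?_
      (c₀.trans d₀.symm) hc
    have := hlin 1
    rwa [map_one] at this
  · exact aeval_cofactor_mem hD' (hpow 6) (genK 6 (by decide +kernel)) hfg hirr haf
      (c₁.trans d₁.symm) hc
  · exact aeval_cofactor_mem hD' (hpow 3) (genK 3 (by decide +kernel)) hfg hirr haf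
      (c₂.trans d₂.symm) hc
  · exact aeval_cofactor_mem hD' hz15 (genF _) hfg hirr (hlin _) (c₃.trans d₃.symm) hc
  · refine aeval_cofactor_mem hD' ?_ (genF _) hfg hirr (hlin _) (c₄.trans d₄.symm) hc
    rw [← pow_mul, mul_comm, pow_mul, hz15, one_pow]
  · have gen := genK 1 (by decide +kernel)
    rw [pow_one] at gen
    exact aeval_cofactor_mem hD' h15 gen hfg hirr haf (c₅.trans d₅.symm) hc
  · exact aeval_cofactor_mem hD' (hpow 11) (genK 11 (by decide +kernel)) hfg hirr haf
      (c₆.trans d₆.symm) hc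
  · exact aeval_cofactor_mem hD' (hpow 2) (genK 2 (by decide +kernel)) hfg hirr haf
      (c₇.trans d₇.symm) hc
  · exact aeval_cofactor_mem hD' (hpow 7) (genK 7 (by decide +kernel)) hfg hirr haf
      (c₈.trans d₈.symm) hc

/-- The shift of the first word by one position has a nonzero value in its first column at `1`,
where the constituent is spanned by `(0, 1)`. -/
theorem isQuasiCyclic_theCode (φ : GF4 ≃+* F)
    (hone : constituent 15 2 (1 : F) (theCode φ) = Submodule.span F {![0, 1]}) :
    IsQuasiCyclic 2 (theCode φ) := by
  refine ⟨⟨by norm_num, shiftInvariant_theCode φ⟩, ?_⟩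
  rintro s ⟨hs, hinv⟩
  by_contra! hlt
  obtain rfl : s = 1 := by omega
  have hmem := hinv _ (pow_shiftMap_mem_left (mapWord φ firstWord) (mapWord φ secondWord) 0)
  have h1 : evalAt 15 2 (1 : F) (fun i => mapWord φ firstWord
      ((finRotate (15 * 2) ^ 1).symm i)) ∈ constituent 15 2 (1 : F) (theCode φ) :=
    Submodule.subset_span ⟨_, hmem, rfl⟩
  rw [hone, Submodule.mem_span_singleton] at h1
  obtain ⟨r, hr⟩ := h1
  have h2 := congrFun hr 0
  rw [evalAt_apply] at h2
  simp only [Pi.smul_apply, Matrix.cons_val_zero, mul_zero, one_pow, smul_eq_mul, mul_one, entry,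
    mapWord] at h2
  rw [← map_sum, eq_comm, map_eq_zero_iff φ φ.injective] at h2
  revert h2
  decide +kernel

theorem columnPoly_mapWord (φ : GF4 ≃+* F) (v : Fin 30 → GF4) (t : Fin 2) :
    columnPoly (mapWord φ v) t =
      ∑ g : Fin 15, C (φ (v (finProdFinEquiv (g, t)))) * X ^ (g : ℕ) :=
  Finset.sum_congr rfl fun _ _ => (C_mul_X_pow_eq_monomial).symm

theorem columnPoly_firstWord (φ : GF4 ≃+* F) :
    columnPoly (mapWord φ firstWord) 0 = f10 (φ GF4.w) ∧
      columnPoly (mapWord φ firstWord) 1 = f11 (φ GF4.w) := by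
  have h0 : ∀ g : Fin 15, firstWord (finProdFinEquiv (g, (0 : Fin 2))) =
      ![0, 0, 0, GF4.w, 0, 1, GF4.w ^ 2, 0, 0, GF4.w ^ 2, 1, 0, GF4.w, 0, 0] g := by decide +kernel
  have h1 : ∀ g : Fin 15, firstWord (finProdFinEquiv (g, (1 : Fin 2))) =
      ![1, GF4.w, 0, GF4.w ^ 2, GF4.w, GF4.w ^ 2, 1, GF4.w ^ 2, 0, 1, GF4.w ^ 2, 0, GF4.w ^ 2,
        GF4.w ^ 2, 0] g := by decide +kernel
  constructor
  · rw [columnPoly_mapWord]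
    simp only [h0, Fin.sum_univ_succ, f10]
    simp
    ring
  · rw [columnPoly_mapWord]
    simp only [h1, Fin.sum_univ_succ, f11]
    simp
    ring

theorem columnPoly_secondWord (φ : GF4 ≃+* F) :
    columnPoly (mapWord φ secondWord) 0 = f20 ∧
      columnPoly (mapWord φ secondWord) 1 = f21 (φ GF4.w) := by
  have h0 : ∀ g : Fin 15, secondWord (finProdFinEquiv (g, (0 : Fin 2))) = 0 := by decide +kernel
  have h1 : ∀ g : Fin 15, secondWord (finProdFinEquiv (g, (1 : Fin 2))) =
      ![0, 1, 1, GF4.w ^ 2, 1, 0, GF4.w, GF4.w, 1, GF4.w, 0, GF4.w ^ 2, GF4.w ^ 2, GF4.w,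
        GF4.w ^ 2] g := by decide +kernel
  constructor
  · rw [columnPoly_mapWord]
    simp only [h0, map_zero, zero_mul, Finset.sum_const_zero, f20]
  · rw [columnPoly_mapWord]
    simp only [h1, Fin.sum_univ_succ, f21]
    simp
    ring

theorem map_polyRep_theCode (φ : GF4 ≃+* F) :
    (theCode φ).map (polyRep 15 2) = (Submodule.span (cycRing F 15)
      {![toR (f10 (φ GF4.w)), toR (f11 (φ GF4.w))],
        ![toR f20, toR (f21 (φ GF4.w))]}).restrictScalars F := by
  rw [theCode, map_polyRep_shiftSpan]
  congr 3
  · funext t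
    rw [polyRep_apply]
    fin_cases t
    · exact congrArg toR (columnPoly_firstWord φ).1
    · exact congrArg toR (columnPoly_firstWord φ).2
  · congr 1
    funext t
    rw [polyRep_apply]
    fin_cases t
    · exact congrArg toR (columnPoly_secondWord φ).1
    · exact congrArg toR (columnPoly_secondWord φ).2

end Constituents

end QubitQC

theorem mainTheorem1 {F K : Type*} [Field F] [DecidableEq F] [Field K] [Algebra F K]
    (hF : Nat.card F = 4) (hK : Nat.card K = 16)
    (z : F) (hz : IsPrimitiveRoot z 3)
    (x : K) (hx : IsPrimitiveRoot x 15) (hxz : x ^ 2 + x + algebraMap F K z = 0) :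
    ((X ^ 15 - 1 : F[X]) = ∏ i, factor z i ∧
      (∀ i, Irreducible (factor z i)) ∧
      ∀ i, aeval (point z x i) (factor z i) = 0) ∧
    ∃ D : Submodule F (Fin (15 * 2) → F),
      (IsQuasiCyclic 2 D ∧ HasConstituents z x D) ∧
      (∀ D' : Submodule F (Fin (15 * 2) → F),
        ShiftInvariant 2 D' → HasConstituents z x D' → D' = D) ∧
      D.map (polyRep 15 2) =
        (Submodule.span (cycRing F 15)
          {![toR (f10 z), toR (f11 z)], ![toR f20, toR (f21 z)]}).restrictScalars F ∧
      Module.finrank F D = 11 ∧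
      Module.finrank F ↥(D ⊓ hermDual 2 D) = 10 ∧
      IsLinearCode 30 19 7 (hermDual 2 D) ∧
      HasMinDist (D ⊔ hermDual 2 D) 6 ∧
      (∃ Q : Submodule ℂ (QState 31), IsQubitCode 31 9 7 Q) ∧
      (∃ Q : Submodule ℂ (QState 31), IsQubitCode 31 8 7 Q) ∧
      (∃ Q : Submodule ℂ (QState 32), IsQubitCode 32 9 7 Q) ∧
      (∃ Q : Submodule ℂ (QState 30), IsQubitCode 30 9 6 Q) := by
  obtain ⟨φ, rfl⟩ := exists_gf4_equiv hF hz
  obtain ⟨ψ, hψ, rfl, hC⟩ := exists_gf16_hom hK φ hxz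
  have := charP_two_of_gf4_equiv φ
  have h15 := hx.pow_eq_one
  have hconst := hasConstituents_theCode hC h15
  have hinv := shiftInvariant_theCode φ
  obtain ⟨S, hS⟩ := exists_isAdditiveCode_thirtyOne φ
  obtain ⟨S', hS'⟩ := exists_isAdditiveCode_thirty φ
  refine ⟨⟨prod_factor hz, irreducible_factor φ, aeval_point_factor hC⟩, theCode φ,
    ⟨isQuasiCyclic_theCode φ hconst.1, hconst⟩, fun D' hD' hconst' => le_antisymm ?_ ?_,
    map_polyRep_theCode φ, finrank_theCode φ, finrank_theHull φ,
    ⟨Fintype.card_fin 30, finrank_hermDual_theCode φ, hasMinDist_hermDual_theCode φ⟩,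
    hasMinDist_sup φ, hS.exists_isQubitCode, ?_, ?_, ?_⟩
  · exact le_of_hasConstituents hz hψ hC h15 hinv hconst' hconst
  · exact le_of_hasConstituents hz hψ hC h15 hD' hconst hconst'
  · obtain ⟨T, hT⟩ := hS.exists_subcode (by norm_num)
    exact hT.exists_isQubitCode
  · obtain ⟨T, hT⟩ := hS.exists_lengthening
    exact hT.exists_isQubitCode
  · obtain ⟨T, hT⟩ := hS'.exists_subcode (by norm_num)
    exact hT.exists_isQubitCode
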